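/- **Quandles.** Let $(X,*)$ be a quandle, $G_X=\langle x\in X\mid x*y=y^{-1}xy\rangle$ its associated group, and $Y$ an $X$-set, i.e. a set with a right action of $G_X$, written $r*g$. A symmetric quandle $(Z,\rho)$ is a quandle with an involution $\rho$ such that $\rho(x*y)=\rho(x)*y$ and $x*\rho(y)=x*y^{-1}$; its associated group is $G_{(Z,\rho)}=\langle x\in Z\mid x*y=y^{-1}xy,\ \rho(x)=x^{-1}\rangle$, and a $(Z,\rho)$-set is a set with a right action of $G_{(Z,\rho)}$. The symmetric double of $X$ is $D_X=\{x^{\varepsilon}\mid x\in X,\varepsilon=\pm1\}$ with $x^\varepsilon\star y^\delta=(x*y^\delta)^\varepsilon$ and $\rho(x^\varepsilon)=x^{-\varepsilon}$; the homomorphism $G_{(D_X,\rho)}\to G_X$, $x^{\varepsilon}\mapsto x^{\varepsilon}$, makes $Y$ a $(D_X,\rho)$-set. **Chains.** For a quandle $Z$ acting on $Y$ let $C_n(Z)_Y$ ($n\ge1$) be the free abelian group on $Y\times Z^n$, with $$\partial_n(r,x_1,\dots,x_n)=\sum_{i=1}^n(-1)^i\big\{(r,x_1,\dots,\widehat{x_i},\dots,x_n)-(r*x_i,x_1*x_i,\dots,x_{i-1}*x_i,\widehat{x_i},x_{i+1},\dots,x_n)\big\}.$$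 $C_n^{\rm Q}(X)_Y$ is the quotient of $C_n(X)_Y$ by the tuples with $x_i=x_{i+1}$ for some $i$; $C_n^{\rm SQ}(Z,\rho)_Y$ is the quotient of $C_n(Z)_Y$ by these tuples and by the elements $(r,x_1,\dots,x_n)+(r*x_i,x_1*x_i,\dots,x_{i-1}*x_i,\rho(x_i),x_{i+1},\dots,x_n)$. A homomorphism from $C^{\rm Q}_n$ or $C^{\rm SQ}_n$ to an abelian group $A$ is an $n$-cocycle if it vanishes on the boundaries $\partial_{n+1}c$. Let $T_n: C_n^{\rm SQ}(D_X,\rho)_Y\to C_n^{\rm Q}(X)_Y$ send a tuple to $\delta(s,y_1,\dots,y_n)$, where $\delta(s,y_1^{+1},\dots,y_n^{+1})$ is its canonical form: for $i=n,n-1,\dots,1$ in turn, if the $i$-th entry has sign $-1$, replace the signed tuple $\delta(s,y_1,\dots,y_n)$ by $-\delta(s\star y_i,y_1\star y_i,\dots,y_{i-1}\star y_i,\rho(y_i),y_{i+1},\dots,y_n)$ (here $y_j\in D_X$). **Diagrams.** A surface-link is a closed orientable surface smoothly embedded in $\mathbb R^4=\mathbb R^3\times\mathbb R$; assume that its projection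 to $\mathbb R^3$ is generic, i.e. locally diffeomorphic to one, two or three coordinate planes or to the Whitney umbrella $(u,v)\mapsto(u,v^2,uv)$. The diagram $D$ is the projection with the height information. Its sheets (semi-sheets) are the connected components of the surface after removing the closure of the set of lower multiple points (of all multiple points); its complementary regions are the components of the complement of the projection in $\mathbb R^3$. An orientation $o=(o_1,o_2)$ is represented by the unit normal $n$ for which $(o_1,o_2,n)$ is right-handed. An $X_Y$-coloring of $(D,o)$ assigns an element of $X$ to each sheet and an element of $Y$ to each region such that (i) if, at a double curve, the normal orientation of the over-sheet with label $x_3$ points from the under-sheet with label $x_1$ to the under-sheet with label $x_2$, then $x_1*x_3=x_2$; (ii) if the normal orientation of a sheet with label $x$ points from a region with label $r_1$ to one with label $r_2$, then $r_1*x=r_2$. A $(Z,\rho)_Y$-coloring of $D$ is a class of assignments of a normal orientation and an element of $Z$ to each semi-sheet and of an element of $Y$ to each region satisfying (ii) and, at each double curve: the labels $x_1,x_2$ of the two over-semi-sheets satisfy $x_1=x_2$ if their normal orientations are coherent and $x_1=\rho(x_2)$ otherwise; and if the normal orientation of an over-semi-sheet with label $x_3$ points from the under-semi-sheet with label $x_1$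 to that with label $x_2$, then $x_1*x_3=x_2$ if the normal orientations of the under-semi-sheets are coherent and $x_1*x_3=\rho(x_2)$ otherwise. Assignments are equivalent if they are related by basic inversions (reverse the normal orientation of a semi-sheet and replace its label $x$ by $\rho(x)$). **Weights.** At a triple point with a specified adjacent region $\gamma$, take the bottom, middle and top (semi-)sheets facing $\gamma$, with normal orientations pointing from $\gamma$ (after basic inversions). If $x_1,x_2,x_3$ and $r$ are the labels of the bottom, middle and top sheets and of $\gamma$, the weight is $\varepsilon(r,x_1,x_2,x_3)$, where $\varepsilon=+1$ if the normals of the top, middle and bottom sheets, in this order, are right-handed, and $\varepsilon=-1$ otherwise. For $X_Y$-colorings of $(D,o)$, $\gamma$ is the region from which the normal orientations representing $o$ all point; for $(Z,\rho)_Y$-colorings $\gamma$ is arbitrary. Let $W(D,C)$ be the sum of the weights of all triple points, in $C_3^{\rm Q}(X)_Y$, respectively $C_3^{\rm SQ}(Z,\rho)_Y$. Each $(D_X,\rho)_Y$-coloring has a unique representative all of whose labels on semi-sheets lie in $X^{+1}$, its canonical form, and the normal orientations of the latter determine an orientation of $D$. Two such colorings are orientation equivalent if these orientations coincide; $[C]_{\rm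 ori}$ denotes the class of $C$. **Theorem.** Let $A$ be an abelian group, and let $\theta^{\rm Q}:C_3^{\rm Q}(X)_Y\to A$ and $\theta^{\rm SQ}:C_3^{\rm SQ}(D_X,\rho)_Y\to A$ be a quandle $3$-cocycle and a symmetric quandle $3$-cocycle with $\theta^{\rm Q}\circ T_3=\theta^{\rm SQ}$. Let $(D,o)$ be a diagram of an oriented surface-link, and let $[C]_{\rm ori}$ be an orientation equivalence class of $(D_X,\rho)_Y$-colorings of $D$ whose canonical forms induce the orientation $o$. Then, for every choice of the specified regions, as multi-sets (possibly with infinite multiplicities), $$\{\theta^{\rm Q}(W(D,C'))\mid C'\ \text{an } X_Y\text{-coloring of }(D,o)\}=\{\theta^{\rm SQ}(W(D,C'))\mid C'\in[C]_{\rm ori}\}.$$ -/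

import Mathlib

open scoped Manifold ContDiff Topology Quandles

noncomputable section

namespace SymDouble

/-! ### Quandles, symmetric quandles and their associated groups

Mathlib's `Quandle` is written with left actions: the right operation `x * y` of knot theory is
`y ◃ x`, and `x * y⁻¹` is `y ◃⁻¹ x`. -/

/-- The associated group `⟨x ∈ X | x * y = y⁻¹ x y⟩` of a quandle. -/
def AssocGroup (X : Type*) [Quandle X] : Type _ :=
  PresentedGroup (Set.range fun q : X × X =>
    FreeGroup.of (q.2 ◃ q.1) *
      ((FreeGroup.of q.2)⁻¹ * FreeGroup.of q.1 * FreeGroup.of q.2)⁻¹)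

instance (X : Type*) [Quandle X] : Group (AssocGroup X) :=
  inferInstanceAs (Group (PresentedGroup _))

/-- The generator of the associated group given by an element of the quandle. -/
def AssocGroup.of {X : Type*} [Quandle X] (x : X) : AssocGroup X := PresentedGroup.of x

/-- An `X`-set is a set `Y` with a right action of the associated group, that is,
`MulAction (AssocGroup X)ᵐᵒᵖ Y`.  This is the element `r * x`. -/
def setAct {X Y : Type*} [Quandle X] [MulAction (AssocGroup X)ᵐᵒᵖ Y] (r : Y) (x : X) : Y :=
  MulOpposite.op (AssocGroup.of x) • r

/-- A symmetric quandle: a quandle with a good involution `rho`. -/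
class SymmetricQuandle (X : Type*) extends Quandle X where
  rho : X → X
  rho_rho : ∀ x, rho (rho x) = x
  rho_act : ∀ x y : X, rho (y ◃ x) = y ◃ rho x
  act_rho : ∀ x y : X, rho y ◃ x = y ◃⁻¹ x


/-- The associated group `⟨x ∈ X | x * y = y⁻¹ x y, ρ(x) = x⁻¹⟩` of a symmetric quandle. -/
def SymAssocGroup (X : Type*) [SymmetricQuandle X] : Type _ :=
  PresentedGroup ((Set.range fun q : X × X =>
    FreeGroup.of (q.2 ◃ q.1) *
      ((FreeGroup.of q.2)⁻¹ * FreeGroup.of q.1 * FreeGroup.of q.2)⁻¹) ∪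
    Set.range fun x : X => FreeGroup.of (SymmetricQuandle.rho x) * FreeGroup.of x)

instance (X : Type*) [SymmetricQuandle X] : Group (SymAssocGroup X) :=
  inferInstanceAs (Group (PresentedGroup _))

/-- The generator of the associated group given by an element of the symmetric quandle. -/
def SymAssocGroup.of {X : Type*} [SymmetricQuandle X] (x : X) : SymAssocGroup X :=
  PresentedGroup.of x

/-- An `(X, ρ)`-set is a set `Y` with a right action of the associated group of `(X, ρ)`.
This is the element `r * x`. -/
def symSetAct {X Y : Type*} [SymmetricQuandle X] [MulAction (SymAssocGroup X)ᵐᵒᵖ Y]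
    (r : Y) (x : X) : Y :=
  MulOpposite.op (SymAssocGroup.of x) • r

/-! ### The symmetric double -/

/-- The underlying set `D_X = X⁺¹ ⊔ X⁻¹` of the double of `X`; the element `⟨x, true⟩` is `x⁺¹`
and `⟨x, false⟩` is `x⁻¹`. -/
@[ext]
structure Double (X : Type*) where
  elt : X
  pos : Bool

/-- `x * y⁺¹ = x * y` for the sign `true`, and `x * y⁻¹` for the sign `false`. -/
def opSign {X : Type*} [Quandle X] (x y : X) (δ : Bool) : X :=
  if δ then y ◃ x else y ◃⁻¹ x

/-- The symmetric double `(D_X, ρ)` of `X`, with `x^ε ⋆ y^δ = (x * y^δ)^ε` and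
`ρ(x^ε) = x^(-ε)`. -/
instance (X : Type*) [Quandle X] : SymmetricQuandle (Double X) where
  act y x := ⟨opSign x.elt y.elt y.pos, x.pos⟩
  invAct y x := ⟨opSign x.elt y.elt (!y.pos), x.pos⟩
  self_distrib := by
    rintro ⟨x, _ | _⟩ ⟨y, _ | _⟩ ⟨z, ε⟩ <;> simp only [opSign, Double.mk.injEq, and_true] <;>
      simp only [if_true, Bool.false_eq_true, if_false]
    · exact Rack.self_distrib_inv
    · rw [← Rack.left_cancel x]
      simp [Rack.self_distrib]
    · rw [← Rack.left_cancel (x ◃ y)]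
      rw [← Rack.self_distrib]
      simp
    · exact Rack.self_distrib
  left_inv := by
    rintro ⟨x, _ | _⟩ ⟨y, ε⟩ <;> simp [opSign]
  right_inv := by
    rintro ⟨x, _ | _⟩ ⟨y, ε⟩ <;> simp [opSign]
  fix := by
    rintro ⟨x, _ | _⟩ <;> simp [opSign]
  rho x := ⟨x.elt, !x.pos⟩
  rho_rho := by rintro ⟨x, ε⟩; simp
  rho_act := by rintro ⟨x, ε⟩ ⟨y, δ⟩; rfl
  act_rho := by rintro ⟨x, ε⟩ ⟨y, δ⟩; rfl

section Projection

variable {X : Type*} [Quandle X]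

theorem AssocGroup.of_act (x y : X) :
    AssocGroup.of (y ◃ x) = (AssocGroup.of y)⁻¹ * AssocGroup.of x * AssocGroup.of y := by
  have h := PresentedGroup.one_of_mem
    (rels := Set.range fun q : X × X => FreeGroup.of (q.2 ◃ q.1) *
      ((FreeGroup.of q.2)⁻¹ * FreeGroup.of q.1 * FreeGroup.of q.2)⁻¹) ⟨(x, y), rfl⟩
  simp only [map_mul, map_inv] at h
  exact mul_inv_eq_one.mp h

theorem AssocGroup.of_invAct (x y : X) :
    AssocGroup.of (y ◃⁻¹ x) = AssocGroup.of y * AssocGroup.of x * (AssocGroup.of y)⁻¹ := by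
  have h := AssocGroup.of_act (y ◃⁻¹ x) y
  rw [Rack.act_invAct_eq] at h
  rw [h]
  group

/-- The element `x^ε` of the associated group of `X`. -/
def AssocGroup.ofDouble (x : Double X) : AssocGroup X :=
  if x.pos then AssocGroup.of x.elt else (AssocGroup.of x.elt)⁻¹

/-- The homomorphism `π` from the associated group of the symmetric double of `X` to the
associated group of `X`, with `π(x^ε) = x^ε`. -/
def doubleProj (X : Type*) [Quandle X] : SymAssocGroup (Double X) →* AssocGroup X :=
  PresentedGroup.toGroup (f := AssocGroup.ofDouble) (by
    rintro _ (⟨⟨⟨x, _ | _⟩, ⟨y, _ | _⟩⟩, rfl⟩ | ⟨⟨x, _ | _⟩, rfl⟩) <;>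
    simp [AssocGroup.ofDouble, Shelf.act, opSign, SymmetricQuandle.rho, AssocGroup.of_act,
      AssocGroup.of_invAct] <;> group)

/-- An `X`-set is a `(D_X, ρ)`-set through `π`. -/
instance doubleAction {Y : Type*} [MulAction (AssocGroup X)ᵐᵒᵖ Y] :
    MulAction (SymAssocGroup (Double X))ᵐᵒᵖ Y :=
  MulAction.compHom Y (MonoidHom.op (doubleProj X))

end Projection

/-! ### Chains and cocycles -/

/-- The chain group `C_n(X)_Y`: the free abelian group on `Y × Xⁿ` (for `n ≥ 1`). -/
abbrev Chain (X Y : Type*) (n : ℕ) : Type _ := FreeAbelianGroup (Y × (Fin n → X))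

/-- The boundary homomorphism `∂_{n+1} : C_{n+1}(X)_Y → C_n(X)_Y` (for `n ≥ 1`), where `act r x`
is the element `r * x` of `Y`.  Indices start at `0`, so the sign of the `i`-th summand is
`(-1)^(i+1)`. -/
def boundary {X Y : Type*} [Quandle X] (act : Y → X → Y) (n : ℕ) :
    Chain X Y (n + 1) →+ Chain X Y n :=
  FreeAbelianGroup.lift fun z => ∑ i : Fin (n + 1), (-1 : ℤ) ^ ((i : ℕ) + 1) •
    (FreeAbelianGroup.of (z.1, fun j => z.2 (i.succAbove j)) -
      FreeAbelianGroup.of (act z.1 (z.2 i), fun j =>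
        if j.castSucc < i then z.2 i ◃ z.2 (i.succAbove j) else z.2 (i.succAbove j)))

/-- The subgroup `D_n(X)_Y` generated by the tuples with two equal consecutive entries. -/
def degenerate (X Y : Type*) (n : ℕ) : AddSubgroup (Chain X Y n) :=
  AddSubgroup.closure {c | ∃ z : Y × (Fin n → X),
    (∃ i j : Fin n, (i : ℕ) + 1 = j ∧ z.2 i = z.2 j) ∧ c = FreeAbelianGroup.of z}

/-- For a tuple `(r, x_1, …, x_n)`, the tuple
`(r * x_i, x_1 * x_i, …, x_{i-1} * x_i, ρ(x_i), x_{i+1}, …, x_n)`. -/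
def flipAt {X Y : Type*} [SymmetricQuandle X] [MulAction (SymAssocGroup X)ᵐᵒᵖ Y] {n : ℕ}
    (i : Fin n) (z : Y × (Fin n → X)) : Y × (Fin n → X) :=
  (symSetAct z.1 (z.2 i), fun j =>
    if j < i then z.2 i ◃ z.2 j else if j = i then SymmetricQuandle.rho (z.2 i) else z.2 j)

/-- The subgroup `D_n(X, ρ)_Y`. -/
def symDegenerate (X Y : Type*) [SymmetricQuandle X] [MulAction (SymAssocGroup X)ᵐᵒᵖ Y]
    (n : ℕ) : AddSubgroup (Chain X Y n) :=
  AddSubgroup.closure {c | ∃ (i : Fin n) (z : Y × (Fin n → X)),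
    c = FreeAbelianGroup.of z + FreeAbelianGroup.of (flipAt i z)}

/-- The quandle chain group `C_n^Q(X)_Y`. -/
abbrev QChain (X Y : Type*) (n : ℕ) : Type _ := Chain X Y n ⧸ degenerate X Y n

/-- The symmetric quandle chain group `C_n^SQ(X, ρ)_Y`. -/
abbrev SQChain (X Y : Type*) [SymmetricQuandle X] [MulAction (SymAssocGroup X)ᵐᵒᵖ Y]
    (n : ℕ) : Type _ :=
  Chain X Y n ⧸ (degenerate X Y n ⊔ symDegenerate X Y n)

/-- `θ : C_n^Q(X)_Y → A` is a quandle `n`-cocycle: `θ ∘ ∂_{n+1} = 0`. -/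
def IsQCocycle {X Y A : Type*} [Quandle X] [MulAction (AssocGroup X)ᵐᵒᵖ Y] [AddCommGroup A]
    {n : ℕ} (θ : QChain X Y n →+ A) : Prop :=
  ∀ c : Chain X Y (n + 1), θ (QuotientAddGroup.mk (boundary setAct n c)) = 0

/-- `θ : C_n^SQ(X, ρ)_Y → A` is a symmetric quandle `n`-cocycle: `θ ∘ ∂_{n+1} = 0`. -/
def IsSQCocycle {X Y A : Type*} [SymmetricQuandle X] [MulAction (SymAssocGroup X)ᵐᵒᵖ Y]
    [AddCommGroup A] {n : ℕ} (θ : SQChain X Y n →+ A) : Prop :=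
  ∀ c : Chain X Y (n + 1), θ (QuotientAddGroup.mk (boundary symSetAct n c)) = 0

/-! ### Canonical forms and the homomorphism from `C_n^SQ(D_X, ρ)_Y` to `C_n^Q(X)_Y` -/

section Flip

variable {X Y : Type*} [SymmetricQuandle X] [MulAction (SymAssocGroup X)ᵐᵒᵖ Y] {n : ℕ}

theorem SymAssocGroup.of_act (x y : X) :
    SymAssocGroup.of (y ◃ x) =
      (SymAssocGroup.of y)⁻¹ * SymAssocGroup.of x * SymAssocGroup.of y := by
  have h := PresentedGroup.one_of_mem (rels := (Set.range fun q : X × X =>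
    FreeGroup.of (q.2 ◃ q.1) *
      ((FreeGroup.of q.2)⁻¹ * FreeGroup.of q.1 * FreeGroup.of q.2)⁻¹) ∪
    Set.range fun x : X => FreeGroup.of (SymmetricQuandle.rho x) * FreeGroup.of x)
    (Or.inl ⟨(x, y), rfl⟩)
  simp only [map_mul, map_inv] at h
  exact mul_inv_eq_one.mp h

theorem SymAssocGroup.of_rho (x : X) :
    SymAssocGroup.of (SymmetricQuandle.rho x) = (SymAssocGroup.of x)⁻¹ := by
  have h := PresentedGroup.one_of_mem (rels := (Set.range fun q : X × X =>
    FreeGroup.of (q.2 ◃ q.1) *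
      ((FreeGroup.of q.2)⁻¹ * FreeGroup.of q.1 * FreeGroup.of q.2)⁻¹) ∪
    Set.range fun x : X => FreeGroup.of (SymmetricQuandle.rho x) * FreeGroup.of x)
    (Or.inr ⟨x, rfl⟩)
  simp only [map_mul] at h
  exact eq_inv_of_mul_eq_one_left h

theorem symSetAct_act (r : Y) (x y : X) :
    symSetAct (symSetAct r y) (y ◃ x) = symSetAct (symSetAct r x) y := by
  simp only [symSetAct, smul_smul, ← MulOpposite.op_mul, SymAssocGroup.of_act]
  congr 2
  group

theorem symSetAct_rho (r : Y) (x : X) :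
    symSetAct (symSetAct r x) (SymmetricQuandle.rho x) = r := by
  simp [symSetAct, smul_smul, SymAssocGroup.of_rho]

theorem flipAt_flipAt (i : Fin n) (z : Y × (Fin n → X)) : flipAt i (flipAt i z) = z := by
  refine Prod.ext ?_ (funext fun j => ?_)
  · simp [flipAt, symSetAct_rho]
  · simp only [flipAt, lt_irrefl, if_false, if_true]
    split_ifs with h1 h2
    · rw [SymmetricQuandle.act_rho, Rack.invAct_act_eq]
    · rw [SymmetricQuandle.rho_rho, h2]
    · rfl

theorem flipAt_comm_of_lt {i j : Fin n} (h : i < j) (z : Y × (Fin n → X)) :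
    flipAt i (flipAt j z) = flipAt j (flipAt i z) := by
  refine Prod.ext ?_ (funext fun k => ?_)
  · simp [flipAt, h, h.not_gt, h.ne', symSetAct_act]
  · simp only [flipAt]
    rcases lt_trichotomy k i with hk | rfl | hk
    · simp only [hk, hk.trans h, h, h.not_gt, h.ne', if_true, if_false]
      exact Rack.self_distrib.symm
    · simp [h, h.not_gt, h.ne', SymmetricQuandle.rho_act]
    · simp [hk.not_gt, hk.ne', h.not_gt, h.ne']

theorem flipAt_comm (i j : Fin n) (z : Y × (Fin n → X)) :
    flipAt i (flipAt j z) = flipAt j (flipAt i z) := by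
  rcases lt_trichotomy i j with h | rfl | h
  · exact flipAt_comm_of_lt h z
  · rfl
  · exact (flipAt_comm_of_lt h z).symm

end Flip

section Canonical

variable {X Y : Type*} [Quandle X] [MulAction (AssocGroup X)ᵐᵒᵖ Y] {n : ℕ}

/-- One step of the canonicalization of a signed tuple `δ (s, y_1^{δ_1}, …, y_n^{δ_n})`: if the
`i`-th sign is `-1`, replace it by
`-δ (s * y_i^{δ_i}, (y_1 * y_i^{δ_i})^{δ_1}, …, y_i^{-δ_i}, y_{i+1}^{δ_{i+1}}, …)`. -/
def canonStep (i : Fin n) (t : ℤ × Y × (Fin n → Double X)) : ℤ × Y × (Fin n → Double X) :=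
  if (t.2.2 i).pos then t else (-t.1, flipAt i t.2)

/-- The canonicalization: the steps for the indices `n, n-1, …, 1`, in this order. -/
def canon (z : Y × (Fin n → Double X)) : ℤ × Y × (Fin n → Double X) :=
  (List.finRange n).foldr canonStep (1, z)

/-- The chain `δ (s, y_1, …, y_n)` of `X`, where `δ (s, y_1⁺¹, …, y_n⁺¹)` is the canonical form
of the given tuple. -/
def canonChain (z : Y × (Fin n → Double X)) : Chain X Y n :=
  (canon z).1 • FreeAbelianGroup.of ((canon z).2.1, fun i => ((canon z).2.2 i).elt)

theorem flipAt_pos (i j : Fin n) (z : Y × (Fin n → Double X)) :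
    ((flipAt i z).2 j).pos = if j = i then !(z.2 j).pos else (z.2 j).pos := by
  rcases lt_trichotomy j i with h | rfl | h
  · simp only [flipAt, h, h.ne, if_true, if_false]; rfl
  · simp only [flipAt, lt_irrefl, if_true, if_false]; rfl
  · simp [flipAt, h.not_gt, h.ne']

theorem canonStep_flip_ne {i j : Fin n} (h : j ≠ i) (t : ℤ × Y × (Fin n → Double X)) :
    canonStep j (t.1, flipAt i t.2) = ((canonStep j t).1, flipAt i (canonStep j t).2) := by
  simp only [canonStep, flipAt_pos, if_neg h]
  split_ifs
  · rfl
  · simp [flipAt_comm i j]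

theorem canonStep_flip_self (i : Fin n) (t : ℤ × Y × (Fin n → Double X)) :
    canonStep i (t.1, flipAt i t.2) = (-(canonStep i t).1, (canonStep i t).2) := by
  cases h : (t.2.2 i).pos <;> simp [canonStep, flipAt_pos, h, flipAt_flipAt]

theorem canonStep_neg (i : Fin n) (t : ℤ × Y × (Fin n → Double X)) :
    canonStep i (-t.1, t.2) = (-(canonStep i t).1, (canonStep i t).2) := by
  cases h : (t.2.2 i).pos <;> simp [canonStep, h]

theorem foldr_canonStep_notMem {i : Fin n} (t : ℤ × Y × (Fin n → Double X)) :
    ∀ l : List (Fin n), i ∉ l → l.foldr canonStep (t.1, flipAt i t.2) =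
      ((l.foldr canonStep t).1, flipAt i (l.foldr canonStep t).2)
  | [], _ => rfl
  | a :: l, h => by
    rw [List.mem_cons, not_or] at h
    rw [List.foldr_cons, List.foldr_cons, foldr_canonStep_notMem t l h.2,
      canonStep_flip_ne (Ne.symm h.1)]

theorem foldr_canonStep_mem {i : Fin n} (t : ℤ × Y × (Fin n → Double X)) :
    ∀ l : List (Fin n), l.Nodup → i ∈ l → l.foldr canonStep (t.1, flipAt i t.2) =
      (-(l.foldr canonStep t).1, (l.foldr canonStep t).2)
  | [], _, h => by simp at h
  | a :: l, hn, h => by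
    rw [List.nodup_cons] at hn
    rw [List.foldr_cons, List.foldr_cons]
    by_cases ha : a = i
    · subst ha
      rw [foldr_canonStep_notMem t l hn.1, canonStep_flip_self]
    · have hi : i ∈ l := by
        rcases List.mem_cons.mp h with h | h
        · exact absurd h.symm ha
        · exact h
      rw [foldr_canonStep_mem t l hn.2 hi, canonStep_neg]

theorem canonChain_flip (i : Fin n) (z : Y × (Fin n → Double X)) :
    canonChain (flipAt i z) = -canonChain z := by
  have h := foldr_canonStep_mem (1, z) (List.finRange n) (List.nodup_finRange n)
    (List.mem_finRange i)
  simp only [canonChain, canon]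
  rw [h, neg_smul]

theorem canonStep_elt {i j : Fin n} (hij : (i : ℕ) + 1 = j) (k : Fin n)
    (t : ℤ × Y × (Fin n → Double X)) (h : (t.2.2 i).elt = (t.2.2 j).elt) :
    ((canonStep k t).2.2 i).elt = ((canonStep k t).2.2 j).elt := by
  unfold canonStep
  split_ifs with hp
  · exact h
  · have hp' : (t.2.2 k).pos = false := by simpa using hp
    simp only [flipAt]
    rcases lt_trichotomy k i with hk | rfl | hk
    · have hj : k < j := hk.trans (Fin.lt_def.mpr (by omega))
      simp [hk.not_gt, hk.ne', hj.not_gt, hj.ne', h]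
    · have hj : k < j := Fin.lt_def.mpr (by omega)
      simp only [lt_irrefl, if_false, if_true, hj.not_gt, hj.ne']
      exact h
    · rcases eq_or_lt_of_le (show j ≤ k from Fin.le_def.mpr (by have := Fin.lt_def.mp hk; omega))
        with rfl | hj
      · simp only [hk, if_true, lt_irrefl, if_false]
        simp only [Shelf.act, SymmetricQuandle.rho, opSign, hp', h]
        simp
      · simp only [hk, hj, if_true]
        simp only [Shelf.act, h]

theorem canonChain_degenerate {i j : Fin n} (hij : (i : ℕ) + 1 = j)
    (z : Y × (Fin n → Double X)) (h : z.2 i = z.2 j) :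
    canonChain z ∈ degenerate X Y n := by
  have key : ∀ l : List (Fin n), ((l.foldr canonStep ((1 : ℤ), z)).2.2 i).elt =
      ((l.foldr canonStep ((1 : ℤ), z)).2.2 j).elt := by
    intro l
    induction l with
    | nil => simp [h]
    | cons a l ih => exact canonStep_elt hij a _ ih
  refine AddSubgroup.zsmul_mem _ (AddSubgroup.subset_closure ?_) _
  exact ⟨_, ⟨i, j, hij, key (List.finRange n)⟩, rfl⟩

variable (X Y n) in
/-- The homomorphism `T_n` from `C_n^SQ(D_X, ρ)_Y` to `C_n^Q(X)_Y` that sends the class of a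
tuple to the class of `δ (s, y_1, …, y_n)`, where `δ (s, y_1⁺¹, …, y_n⁺¹)` is its canonical
form. -/
def doubleToQ : SQChain (Double X) Y n →+ QChain X Y n :=
  QuotientAddGroup.lift _
    ((QuotientAddGroup.mk' (degenerate X Y n)).comp (FreeAbelianGroup.lift canonChain)) (by
      rw [sup_le_iff, degenerate, symDegenerate, AddSubgroup.closure_le, AddSubgroup.closure_le]
      constructor
      · rintro _ ⟨z, ⟨i, j, hij, h⟩, rfl⟩
        simpa using canonChain_degenerate hij z h
      · rintro _ ⟨i, z, rfl⟩
        simp [canonChain_flip])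

end Canonical

/-! ### Diagrams of surface-links

`R3` is `ℝ³`, used with its smooth structure and the standard dot product, and `ℝ⁴` is
`R3 × ℝ`; the projection is the first component and the height is the second one. -/

/-- Three-dimensional space. -/
abbrev R3 : Type := Fin 3 → ℝ

/-- A triple of vectors matches the right-handed orientation of `ℝ³`. -/
def RightHanded (a b c : R3) : Prop := 0 < (Matrix.of ![a, b, c]).det

section Charts

variable {M : Type*} [TopologicalSpace M] [ChartedSpace (EuclideanSpace ℝ (Fin 2)) M]
  [IsManifold (𝓡 2) ∞ M]

set_option linter.unusedSectionVars false

/-- A diffeomorphism of an open subset of `ℝ³` onto a convex open set under which the part of the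
projected surface in that open subset becomes the union of the coordinate planes
`x (coord j) = 0`, one for each of `k` sheets.  The part `sheet j` of the surface is mapped
diffeomorphically, with inverse `param j`, onto its coordinate plane.  The sheets are numbered
from the top to the bottom. -/
structure SheetChart (f : M → R3 × ℝ) (k : ℕ) where
  toHomeo : OpenPartialHomeomorph R3 R3
  smooth : ContDiffOn ℝ ∞ toHomeo toHomeo.source
  smooth_symm : ContDiffOn ℝ ∞ toHomeo.symm toHomeo.target
  convex_target : Convex ℝ toHomeo.target
  coord : Fin k ↪ Fin 3
  sheet : Fin k → Set M
  param : Fin k → R3 → M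
  isOpen_sheet : ∀ j, IsOpen (sheet j)
  disjoint_sheet : ∀ i j, i ≠ j → Disjoint (sheet i) (sheet j)
  iUnion_sheet : ⋃ j, sheet j = {p | (f p).1 ∈ toHomeo.source}
  mem_plane : ∀ j, ∀ p ∈ sheet j, toHomeo (f p).1 (coord j) = 0
  param_mem : ∀ j, ∀ x ∈ toHomeo.target, x (coord j) = 0 → param j x ∈ sheet j
  proj_param : ∀ j, ∀ x ∈ toHomeo.target, x (coord j) = 0 → toHomeo (f (param j x)).1 = x
  param_proj : ∀ j, ∀ p ∈ sheet j, param j (toHomeo (f p).1) = p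
  smooth_param : ∀ j, ContMDiffOn 𝓘(ℝ, R3) (𝓡 2) ∞ (param j)
    {x | x ∈ toHomeo.target ∧ x (coord j) = 0}
  above : ∀ i j, i < j → ∀ p ∈ sheet i, ∀ q ∈ sheet j, (f p).1 = (f q).1 → (f q).2 < (f p).2

/-- The coordinate, in the direction across the `j`-th sheet, of a point of `ℝ³`. -/
def SheetChart.side {f : M → R3 × ℝ} {k : ℕ} (c : SheetChart f k) (j : Fin k) (y : R3) : ℝ :=
  c.toHomeo y (c.coord j)

/-- The component, in the direction across the `j`-th sheet, of a vector `v` at the point `y`. -/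
def SheetChart.dside {f : M → R3 × ℝ} {k : ℕ} (c : SheetChart f k) (j : Fin k) (y v : R3) : ℝ :=
  fderiv ℝ c.toHomeo y v (c.coord j)

/-- A neighbourhood of the point `y` of `ℝ³`, diffeomorphic to `ℝ³` with `y` at the origin, in
which the projected surface is the union of the first `k` coordinate planes.  The point `y` is a
regular point for `k = 1`, a double point for `k = 2`, and a triple point for `k = 3`. -/
structure CenteredChart (f : M → R3 × ℝ) (k : ℕ) (y : R3) extends SheetChart f k where
  target_eq : toHomeo.target = Set.univ
  mem_source : y ∈ toHomeo.source
  map_center : toHomeo y = 0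
  coord_eq : ∀ j, (coord j : ℕ) = j

/-- A neighbourhood of the point `y` of `ℝ³`, diffeomorphic to `ℝ³` with `y` at the origin, in
which the projected surface is the Whitney umbrella `(u, v) ↦ (u, v², u v)`: the point `y` is a
branch point. -/
structure BranchChart (f : M → R3 × ℝ) (y : R3) where
  toHomeo : OpenPartialHomeomorph R3 R3
  smooth : ContDiffOn ℝ ∞ toHomeo toHomeo.source
  smooth_symm : ContDiffOn ℝ ∞ toHomeo.symm toHomeo.target
  target_eq : toHomeo.target = Set.univ
  mem_source : y ∈ toHomeo.source
  map_center : toHomeo y = 0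
  coords : M → ℝ × ℝ
  param : ℝ × ℝ → M
  smooth_coords : ContMDiffOn (𝓡 2) 𝓘(ℝ, ℝ × ℝ) ∞ coords {p | (f p).1 ∈ toHomeo.source}
  smooth_param : ContMDiff 𝓘(ℝ, ℝ × ℝ) (𝓡 2) ∞ param
  param_mem : ∀ u, (f (param u)).1 ∈ toHomeo.source
  coords_param : ∀ u, coords (param u) = u
  param_coords : ∀ p, (f p).1 ∈ toHomeo.source → param (coords p) = p
  umbrella : ∀ u v : ℝ, toHomeo (f (param (u, v))).1 = ![u, v ^ 2, u * v]

variable (M) in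
/-- A surface-link in `ℝ⁴` (a smoothly embedded surface; compactness of `M` is assumed separately)
whose projection to `ℝ³` is generic: every point of the projection is a regular point, a double
point, a triple point or a branch point.  It carries all the data of the diagram, which is the
projection with the height information. -/
structure SurfaceDiagram where
  emb : M → R3 × ℝ
  isEmbedding : Manifold.IsSmoothEmbedding (𝓡 2) 𝓘(ℝ, R3 × ℝ) ∞ emb
  generic : ∀ p, (∃ k, Nonempty (CenteredChart emb k (emb p).1)) ∨
    Nonempty (BranchChart emb (emb p).1)

variable (M) in
/-- An orientation of the surface: a choice of an orientation of every tangent plane such that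
every point has a neighbourhood with a positively oriented continuous frame. -/
structure SurfaceOrientation where
  orient : ∀ p : M, Orientation ℝ (TangentSpace (𝓡 2) p) (Fin 2)
  continuous : ∀ p₀ : M, ∃ U ∈ 𝓝 p₀, ∃ e : Fin 2 → ∀ p : M, TangentSpace (𝓡 2) p,
    (∀ i, ContinuousOn (fun p => (⟨p, e i p⟩ : TangentBundle (𝓡 2) M)) U) ∧
    ∀ p ∈ U, ∃ b : Module.Basis (Fin 2) ℝ (TangentSpace (𝓡 2) p),
      (∀ i, b i = e i p) ∧ b.orientation = orient p

namespace SurfaceDiagram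

variable (F : SurfaceDiagram M)

/-- The projection of the surface to `ℝ³`. -/
def proj (p : M) : R3 := (F.emb p).1

/-- The derivative of the projection at a point of the surface. -/
def dproj (p : M) : TangentSpace (𝓡 2) p →L[ℝ] R3 := mfderiv (𝓡 2) 𝓘(ℝ, R3) F.proj p

/-- The vector `v` of `ℝ³` is a unit normal vector of the projected surface at `p`. -/
def IsUnitNormal (p : M) (v : R3) : Prop :=
  v ⬝ᵥ v = 1 ∧ ∀ w : TangentSpace (𝓡 2) p, v ⬝ᵥ F.dproj p w = 0

/-- The vector `v` is the normal orientation at `p` that represents the orientation `o`: the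
triple `(o₁, o₂, v)` is right-handed for every positively oriented basis `(o₁, o₂)` of the
tangent plane. -/
def IsNormal (o : SurfaceOrientation M) (p : M) (v : R3) : Prop :=
  F.IsUnitNormal p v ∧ ∀ b : Module.Basis (Fin 2) ℝ (TangentSpace (𝓡 2) p),
    b.orientation = o.orient p → RightHanded (F.dproj p (b 0)) (F.dproj p (b 1)) v

/-- The lower points: those that lie below another point of the surface. -/
def lowerSet : Set M := {p | ∃ q, F.proj q = F.proj p ∧ (F.emb p).2 < (F.emb q).2}

/-- The (upper or lower) multiple points. -/
def doubleSet : Set M := {p | ∃ q, q ≠ p ∧ F.proj q = F.proj p}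

/-- The points of the sheets.  The closure of the lower points consists of the lower points and
the branch points. -/
abbrev SheetPt : Type _ := ↥(closure F.lowerSet)ᶜ

/-- The sheets. -/
abbrev Sheet : Type _ := ConnectedComponents F.SheetPt

/-- The points of the semi-sheets.  The closure of the multiple points consists of the multiple
points and the branch points. -/
abbrev SemiPt : Type _ := ↥(closure F.doubleSet)ᶜ

/-- The semi-sheets. -/
abbrev SemiSheet : Type _ := ConnectedComponents F.SemiPt

/-- The points of `ℝ³` outside the diagram. -/
abbrev RegionPt : Type := ↥(Set.range F.proj)ᶜ

/-- The complementary regions. -/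
abbrev Region : Type := ConnectedComponents F.RegionPt

/-- The sheet that contains a given point. -/
def sheetOf (p : F.SheetPt) : F.Sheet := ConnectedComponents.mk p

/-- The semi-sheet that contains a given point. -/
def semiOf (p : F.SemiPt) : F.SemiSheet := ConnectedComponents.mk p

/-- The complementary region that contains a given point. -/
def regionOf (y : F.RegionPt) : F.Region := ConnectedComponents.mk y

theorem lowerSet_subset : F.lowerSet ⊆ F.doubleSet := by
  rintro p ⟨q, h1, h2⟩
  exact ⟨q, fun h => by simp [h] at h2, h1⟩

/-- A point of a semi-sheet, as a point of a sheet. -/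
def SemiPt.toSheetPt {F : SurfaceDiagram M} (p : F.SemiPt) : F.SheetPt :=
  ⟨p.1, fun h => p.2 (closure_mono F.lowerSet_subset h)⟩

/-! ### Colorings -/

/-- An `X_Y`-coloring of the oriented diagram `(F, o)`.

In `double_cond`, `d` is a point of the over-sheet (number `0`) and `a`, `b` are points of the two
under-sheets (parts of number `1`) near a double point curve, such that the normal orientation
`v` of the over-sheet points from the side of `a` to the side of `b`; then
`label a * label d = label b`.  In `region_cond`, the normal orientation `v` of the sheet at `p`
points from the region of `y₁` to the region of `y₂`. -/
@[ext]
structure QColoring (o : SurfaceOrientation M) (X Y : Type*) [Quandle X]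
    [MulAction (AssocGroup X)ᵐᵒᵖ Y] where
  label : F.Sheet → X
  region : F.Region → Y
  double_cond : ∀ (c : SheetChart F.emb 2) (a b d : F.SheetPt) (v : R3),
    a.1 ∈ c.sheet 1 → b.1 ∈ c.sheet 1 → d.1 ∈ c.sheet 0 → F.IsNormal o d.1 v →
    c.dside 0 (F.proj d.1) v * c.side 0 (F.proj a.1) < 0 →
    0 < c.dside 0 (F.proj d.1) v * c.side 0 (F.proj b.1) →
    label (F.sheetOf d) ◃ label (F.sheetOf a) = label (F.sheetOf b)
  region_cond : ∀ (c : SheetChart F.emb 1) (p : F.SheetPt) (y₁ y₂ : F.RegionPt) (v : R3),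
    p.1 ∈ c.sheet 0 → y₁.1 ∈ c.toHomeo.source → y₂.1 ∈ c.toHomeo.source → F.IsNormal o p.1 v →
    c.dside 0 (F.proj p.1) v * c.side 0 y₁.1 < 0 →
    0 < c.dside 0 (F.proj p.1) v * c.side 0 y₂.1 →
    setAct (region (F.regionOf y₁)) (label (F.sheetOf p)) = region (F.regionOf y₂)

/-- An assignment of a normal orientation and an element of `X` to each semi-sheet, and of an
element of `Y` to each complementary region, that satisfies the conditions of an
`(X, ρ)_Y`-coloring.  The normal orientations of the semi-sheets are given by a continuous field
of unit normal vectors.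

In `over_cond`, `a` and `b` are points of the two semi-sheets of the over-sheet near a double
point curve.  In `under_cond`, `a` and `b` are points of the two semi-sheets of the under-sheet,
and `d` is a point of a semi-sheet of the over-sheet whose normal orientation points from the side
of `a` to the side of `b`.  Normal orientations at two points of one sheet are coherent if they
point to the same side of the sheet. -/
structure SymAssignment (X Y : Type*) [SymmetricQuandle X]
    [MulAction (SymAssocGroup X)ᵐᵒᵖ Y] where
  normal : F.SemiPt → R3
  continuous_normal : Continuous normal
  isUnitNormal : ∀ p, F.IsUnitNormal p.1 (normal p)
  label : F.SemiSheet → X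
  region : F.Region → Y
  over_cond : ∀ (c : SheetChart F.emb 2) (a b : F.SemiPt),
    a.1 ∈ c.sheet 0 → b.1 ∈ c.sheet 0 →
    c.side 1 (F.proj a.1) < 0 → 0 < c.side 1 (F.proj b.1) →
    (0 < c.dside 0 (F.proj a.1) (normal a) * c.dside 0 (F.proj b.1) (normal b) →
      label (F.semiOf a) = label (F.semiOf b)) ∧
    (c.dside 0 (F.proj a.1) (normal a) * c.dside 0 (F.proj b.1) (normal b) < 0 →
      label (F.semiOf a) = SymmetricQuandle.rho (label (F.semiOf b)))
  under_cond : ∀ (c : SheetChart F.emb 2) (a b d : F.SemiPt),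
    a.1 ∈ c.sheet 1 → b.1 ∈ c.sheet 1 → d.1 ∈ c.sheet 0 →
    c.dside 0 (F.proj d.1) (normal d) * c.side 0 (F.proj a.1) < 0 →
    0 < c.dside 0 (F.proj d.1) (normal d) * c.side 0 (F.proj b.1) →
    (0 < c.dside 1 (F.proj a.1) (normal a) * c.dside 1 (F.proj b.1) (normal b) →
      label (F.semiOf d) ◃ label (F.semiOf a) = label (F.semiOf b)) ∧
    (c.dside 1 (F.proj a.1) (normal a) * c.dside 1 (F.proj b.1) (normal b) < 0 →
      label (F.semiOf d) ◃ label (F.semiOf a) = SymmetricQuandle.rho (label (F.semiOf b)))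
  region_cond : ∀ (c : SheetChart F.emb 1) (p : F.SemiPt) (y₁ y₂ : F.RegionPt),
    p.1 ∈ c.sheet 0 → y₁.1 ∈ c.toHomeo.source → y₂.1 ∈ c.toHomeo.source →
    c.dside 0 (F.proj p.1) (normal p) * c.side 0 y₁.1 < 0 →
    0 < c.dside 0 (F.proj p.1) (normal p) * c.side 0 y₂.1 →
    symSetAct (region (F.regionOf y₁)) (label (F.semiOf p)) = region (F.regionOf y₂)

section Sym

variable {F}
variable {X Y : Type*} [SymmetricQuandle X] [MulAction (SymAssocGroup X)ᵐᵒᵖ Y]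

/-- Two assignments are related by basic inversions on some of the semi-sheets: on each of these
the normal orientation is reversed and the label `x` is replaced by `ρ(x)`. -/
def SymAssignment.Inverted (a b : F.SymAssignment X Y) : Prop :=
  a.region = b.region ∧ ∀ p : F.SemiPt,
    (b.normal p = a.normal p ∧ b.label (F.semiOf p) = a.label (F.semiOf p)) ∨
    (b.normal p = -a.normal p ∧
      b.label (F.semiOf p) = SymmetricQuandle.rho (a.label (F.semiOf p)))

variable (F X Y) in
/-- The equivalence relation on assignments generated by the basic inversions. -/
def inversionSetoid : Setoid (F.SymAssignment X Y) where
  r := SymAssignment.Inverted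
  iseqv := by
    refine ⟨fun a => ⟨rfl, fun p => Or.inl ⟨rfl, rfl⟩⟩, ?_, ?_⟩
    · rintro a b ⟨hr, h⟩
      refine ⟨hr.symm, fun p => ?_⟩
      rcases h p with ⟨h1, h2⟩ | ⟨h1, h2⟩
      · exact Or.inl ⟨h1.symm, h2.symm⟩
      · exact Or.inr ⟨by rw [h1, neg_neg], by rw [h2, SymmetricQuandle.rho_rho]⟩
    · rintro a b c ⟨hr, h⟩ ⟨hr', h'⟩
      refine ⟨hr.trans hr', fun p => ?_⟩
      rcases h p with ⟨h1, h2⟩ | ⟨h1, h2⟩ <;> rcases h' p with ⟨h3, h4⟩ | ⟨h3, h4⟩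
      · exact Or.inl ⟨h3.trans h1, h4.trans h2⟩
      · exact Or.inr ⟨by rw [h3, h1], by rw [h4, h2]⟩
      · exact Or.inr ⟨by rw [h3, h1], by rw [h4, h2]⟩
      · exact Or.inl ⟨by rw [h3, h1, neg_neg], by rw [h4, h2, SymmetricQuandle.rho_rho]⟩

variable (F X Y) in
/-- The set of `(X, ρ)_Y`-colorings of the unoriented diagram `F`. -/
def SymColoring : Type _ := Quotient (inversionSetoid F X Y)

end Sym

/-! ### Triple points and their weights -/

/-- The triple points of the diagram. -/
abbrev TriplePt : Type := {y : R3 // Nonempty (CenteredChart F.emb 3 y)}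

variable {F}

/-- A chart around a triple point.  The sheets `0`, `1`, `2` are the top, the middle and the bottom
sheet, and they are the planes on which the coordinates `0`, `1`, `2` vanish. -/
def TriplePt.chart (τ : F.TriplePt) : CenteredChart F.emb 3 τ.1 := Classical.choice τ.2

/-- The eight complementary regions around a triple point correspond to the signs of the three
coordinates. -/
abbrev Octant : Type := Fin 3 → ℤˣ

/-- A point of the given octant. -/
def Octant.point (ε : Octant) : R3 := fun j => ((ε j : ℤ) : ℝ)

theorem Octant.point_ne_zero (ε : Octant) (j : Fin 3) : ε.point j ≠ 0 := by
  simp [Octant.point]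

/-- A point of `ℝ³` in the region around the triple point given by an octant. -/
def TriplePt.regionPt (τ : F.TriplePt) (ε : Octant) : F.RegionPt :=
  ⟨τ.chart.toHomeo.symm ε.point, by
    rintro ⟨p, hp⟩
    have ht : ε.point ∈ τ.chart.toHomeo.target := by rw [τ.chart.target_eq]; trivial
    have hs : p ∈ ⋃ j, τ.chart.sheet j := by
      rw [τ.chart.iUnion_sheet]
      change F.proj p ∈ τ.chart.toHomeo.source
      rw [hp]
      exact τ.chart.toHomeo.map_target ht
    obtain ⟨j, hj⟩ := Set.mem_iUnion.mp hs
    have h0 := τ.chart.mem_plane j p hj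
    change τ.chart.toHomeo (F.proj p) _ = 0 at h0
    rw [hp, τ.chart.toHomeo.right_inv ht] at h0
    exact ε.point_ne_zero _ h0⟩

/-- A point of a sheet of a chart that lies on no other sheet of the chart is a point of a
semi-sheet. -/
theorem notMem_closure_doubleSet {k : ℕ} (c : SheetChart F.emb k) {j : Fin k} {p : M}
    (hp : p ∈ c.sheet j) (h : ∀ i, i ≠ j → c.side i (F.proj p) ≠ 0) :
    p ∉ closure F.doubleSet := by
  have hsub : ∀ i, ∀ q ∈ c.sheet i, F.proj q ∈ c.toHomeo.source := fun i q hq => by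
    have : q ∈ ⋃ i, c.sheet i := Set.mem_iUnion.mpr ⟨i, hq⟩
    rw [c.iUnion_sheet] at this
    exact this
  have hproj : Continuous F.proj := continuous_fst.comp F.isEmbedding.isEmbedding.continuous
  have hcont : ∀ i, ContinuousAt (fun q => c.side i (F.proj q)) p := fun i =>
    (continuous_apply (c.coord i)).continuousAt.comp
      (ContinuousAt.comp (g := c.toHomeo)
        (c.toHomeo.continuousAt (hsub j p hp)) hproj.continuousAt)
  have hev : ∀ᶠ q in 𝓝 p, q ∈ c.sheet j ∧ ∀ i, i ≠ j → c.side i (F.proj q) ≠ 0 := by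
    refine ((c.isOpen_sheet j).eventually_mem hp).and (Filter.eventually_all.mpr fun i => ?_)
    by_cases hi : i = j
    · exact Filter.Eventually.of_forall fun q hq => absurd hi hq
    · exact ((hcont i).eventually_ne (h i hi)).mono fun q hq _ => hq
  intro hcl
  obtain ⟨q, ⟨hq1, hq2⟩, q', hne, hq'⟩ := mem_closure_iff_nhds.mp hcl _ hev
  have hs : q' ∈ ⋃ i, c.sheet i := by
    rw [c.iUnion_sheet]
    change F.proj q' ∈ c.toHomeo.source
    rw [hq']
    exact hsub j q hq1
  obtain ⟨i, hi⟩ := Set.mem_iUnion.mp hs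
  by_cases hij : i = j
  · subst hij
    apply hne
    rw [← c.param_proj i q' hi, ← c.param_proj i q hq1]
    change c.param i (c.toHomeo (F.proj q')) = c.param i (c.toHomeo (F.proj q))
    rw [hq']
  · apply hq2 i hij
    have h0 := c.mem_plane i q' hi
    change c.toHomeo (F.proj q') (c.coord i) = 0 at h0
    rwa [hq'] at h0

theorem TriplePt.coord_eq (τ : F.TriplePt) (j : Fin 3) : τ.chart.coord j = j :=
  Fin.ext (τ.chart.coord_eq j)

/-- A point of the semi-sheet of the `j`-th sheet that faces the region around the triple point
given by an octant. -/
def TriplePt.facePt (τ : F.TriplePt) (ε : Octant) (j : Fin 3) : F.SemiPt :=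
  ⟨τ.chart.param j (Function.update ε.point j 0), by
    have ht : Function.update ε.point j 0 ∈ τ.chart.toHomeo.target := by
      rw [τ.chart.target_eq]; trivial
    have h0 : Function.update ε.point j 0 (τ.chart.coord j) = 0 := by
      rw [τ.coord_eq]; simp
    refine notMem_closure_doubleSet τ.chart.toSheetChart (τ.chart.param_mem j _ ht h0) ?_
    intro i hi
    change τ.chart.toHomeo (F.emb _).1 _ ≠ 0
    rw [τ.chart.proj_param j _ ht h0, τ.coord_eq, Function.update_of_ne hi]
    exact ε.point_ne_zero i⟩

theorem TriplePt.facePt_mem (τ : F.TriplePt) (ε : Octant) (j : Fin 3) :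
    (τ.facePt ε j).1 ∈ τ.chart.sheet j := by
  refine τ.chart.param_mem j _ (by rw [τ.chart.target_eq]; trivial) ?_
  rw [τ.coord_eq]; simp

theorem dside_neg {k : ℕ} (c : SheetChart F.emb k) (j : Fin k) (y v : R3) :
    c.dside j y (-v) = -c.dside j y v := by
  simp [SheetChart.dside]

/-- A unit normal vector of a sheet points to one of the two sides of the sheet. -/
theorem dside_ne_zero {k : ℕ} (c : SheetChart F.emb k) {j : Fin k} {p : M}
    (hp : p ∈ c.sheet j) {v : R3} (hv : F.IsUnitNormal p v) : c.dside j (F.proj p) v ≠ 0 := by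
  intro h0
  have hsrc : ∀ q ∈ c.sheet j, F.proj q ∈ c.toHomeo.source := fun q hq => by
    have : q ∈ ⋃ i, c.sheet i := Set.mem_iUnion.mpr ⟨j, hq⟩
    rw [c.iUnion_sheet] at this
    exact this
  set y := F.proj p with hy
  have hys : y ∈ c.toHomeo.source := hsrc p hp
  set x := c.toHomeo y with hx
  have hxt : x ∈ c.toHomeo.target := c.toHomeo.map_source hys
  have hx0 : x (c.coord j) = 0 := c.mem_plane j p hp
  set u : R3 := fderiv ℝ c.toHomeo y v with hu
  have hu0 : u (c.coord j) = 0 := h0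
  -- the line through `x` in the direction `u`
  let l : ℝ → R3 := fun t => x + t • u
  have hl : HasDerivAt l u 0 := by
    have h1 := ((hasDerivAt_id (0 : ℝ)).smul_const u).const_add x
    rw [one_smul] at h1
    exact h1
  have hl0 : l 0 = x := by simp [l]
  have hlt : ∀ᶠ t in 𝓝 (0 : ℝ), l t ∈ c.toHomeo.target :=
    hl.continuousAt.eventually_mem (by rw [hl0]; exact c.toHomeo.open_target.mem_nhds hxt)
  have hlc : ∀ t, l t (c.coord j) = 0 := fun t => by simp [l, hx0, hu0]
  have hdφ : DifferentiableAt ℝ c.toHomeo y :=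
    (c.smooth.contDiffAt (c.toHomeo.open_source.mem_nhds hys)).differentiableAt (by simp)
  have hdψ : DifferentiableAt ℝ c.toHomeo.symm x :=
    (c.smooth_symm.contDiffAt (c.toHomeo.open_target.mem_nhds hxt)).differentiableAt (by simp)
  have hψx : c.toHomeo.symm x = y := c.toHomeo.left_inv hys
  have hψu : fderiv ℝ c.toHomeo.symm x u = v := by
    have h1 : HasFDerivAt (c.toHomeo.symm ∘ c.toHomeo)
        ((fderiv ℝ c.toHomeo.symm x).comp (fderiv ℝ c.toHomeo y)) y :=
      hdψ.hasFDerivAt.comp y hdφ.hasFDerivAt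
    have h2 : HasFDerivAt (c.toHomeo.symm ∘ c.toHomeo) (ContinuousLinearMap.id ℝ R3) y := by
      refine (hasFDerivAt_id y).congr_of_eventuallyEq ?_
      filter_upwards [c.toHomeo.open_source.mem_nhds hys] with z hz
      exact c.toHomeo.left_inv hz
    have h3 := congrArg (fun L => L v) (h1.unique h2)
    simpa using h3
  have hcurve : HasDerivAt (fun t => c.toHomeo.symm (l t)) v 0 := by
    rw [← hψu]
    have := hdψ.hasFDerivAt
    rw [← hl0] at this
    have h1 := this.comp_hasDerivAt (0 : ℝ) hl
    rw [hl0] at h1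
    exact h1
  have hpar0 : c.param j (l 0) = p := by rw [hl0]; exact c.param_proj j p hp
  have hlift : MDifferentiableAt 𝓘(ℝ, ℝ) (𝓡 2) (fun t => c.param j (l t)) 0 := by
    have h1 := (c.smooth_param j).mdifferentiableOn (by simp) (l 0) ⟨hl0 ▸ hxt, hlc 0⟩
    have h2 : MDifferentiableAt 𝓘(ℝ, ℝ) 𝓘(ℝ, R3) l 0 :=
      hl.differentiableAt.mdifferentiableAt
    have h3 : MDifferentiableWithinAt 𝓘(ℝ, ℝ) (𝓡 2) (c.param j ∘ l)
        (l ⁻¹' {x | x ∈ c.toHomeo.target ∧ x (c.coord j) = 0}) 0 :=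
      h1.comp (0 : ℝ) h2.mdifferentiableWithinAt subset_rfl
    refine h3.mdifferentiableAt ?_
    filter_upwards [hlt] with t ht
    exact ⟨ht, hlc t⟩
  have hprojd : MDifferentiableAt (𝓡 2) 𝓘(ℝ, R3) F.proj (c.param j (l 0)) := by
    have h1 : MDifferentiableAt (𝓡 2) 𝓘(ℝ, R3 × ℝ) F.emb (c.param j (l 0)) :=
      F.isEmbedding.contMDiff.mdifferentiableAt (by simp)
    have h2 : MDifferentiableAt 𝓘(ℝ, R3 × ℝ) 𝓘(ℝ, R3) Prod.fst (F.emb (c.param j (l 0))) :=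
      differentiableAt_fst.mdifferentiableAt
    exact h2.comp _ h1
  have hcomp := (HasMFDerivAt.comp (0 : ℝ) hprojd.hasMFDerivAt
    hlift.hasMFDerivAt).hasFDerivAt
  have hcurve2 : HasFDerivAt (F.proj ∘ fun t => c.param j (l t)) _ (0 : ℝ) :=
    hcurve.hasFDerivAt.congr_of_eventuallyEq (by
      filter_upwards [hlt] with t ht
      have h1 := c.proj_param j (l t) ht (hlc t)
      change c.toHomeo (F.proj (c.param j (l t))) = l t at h1
      rw [Function.comp_apply, ← h1, c.toHomeo.left_inv (hsrc _ (c.param_mem j _ ht (hlc t))), h1])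
  have hv1 : F.IsUnitNormal (c.param j (l 0)) v := by rw [hpar0]; exact hv
  have h1 := congrArg (fun L : ℝ →L[ℝ] R3 => L 1) (hcurve2.unique hcomp)
  have h2 : v = F.dproj (c.param j (l 0))
      (mfderiv 𝓘(ℝ, ℝ) (𝓡 2) (fun t => c.param j (l t)) 0 (1 : ℝ)) := by
    simp only [ContinuousLinearMap.toSpanSingleton_apply, one_smul] at h1
    exact h1
  have h3 := hv1.2 (mfderiv 𝓘(ℝ, ℝ) (𝓡 2) (fun t => c.param j (l t)) 0 (1 : ℝ))
  rw [← h2, hv1.1] at h3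
  exact one_ne_zero h3

open Classical in
/-- The sign of a triple point for a specified region: it is `+1` if the normal vectors of the top,
the middle and the bottom sheet at the triple point that point from the region form, in this
order, a right-handed triple, and `-1` otherwise. -/
def TriplePt.sign (τ : F.TriplePt) (ε : Octant) : ℤ :=
  if ∃ w : Fin 3 → R3, (∀ j, F.IsUnitNormal (τ.chart.param j 0) (w j) ∧
      ε.point j * τ.chart.dside j τ.1 (w j) < 0) ∧ RightHanded (w 0) (w 1) (w 2)
  then 1 else -1

open Classical in
/-- The region around a triple point from which the normal orientations of the three sheets that
represent the orientation `o` point. -/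
def TriplePt.source (τ : F.TriplePt) (o : SurfaceOrientation M) : Octant := fun j =>
  if ∃ v, F.IsNormal o (τ.chart.param j 0) v ∧ 0 < τ.chart.dside j τ.1 v then -1 else 1

/-- Every triple point has three preimages on the surface. -/
theorem exists_three_preimages {y : R3} (h : Nonempty (CenteredChart F.emb 3 y)) :
    ∃ q : Fin 3 → M, Function.Injective q ∧ ∀ i, F.proj (q i) = y := by
  obtain ⟨c⟩ := h
  have ht : (0 : R3) ∈ c.toHomeo.target := by rw [c.target_eq]; trivial
  refine ⟨fun i => c.param i 0, fun i j hij => ?_, fun i => ?_⟩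
  · by_contra hne
    refine Set.disjoint_left.mp (c.disjoint_sheet i j hne) (c.param_mem i 0 ht rfl) ?_
    change c.param i 0 = c.param j 0 at hij
    rw [hij]
    exact c.param_mem j 0 ht rfl
  · have hs : c.param i 0 ∈ {p | (F.emb p).1 ∈ c.toHomeo.source} := by
      rw [← c.iUnion_sheet]
      exact Set.mem_iUnion.mpr ⟨i, c.param_mem i 0 ht rfl⟩
    exact c.toHomeo.injOn hs c.mem_source
      ((c.proj_param i 0 ht rfl).trans c.map_center.symm)

/-- A diagram of a closed surface has finitely many triple points, so that the sums of weights
below are finite. -/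
theorem finite_triplePt [CompactSpace M] : Finite F.TriplePt := by
  have hproj : Continuous F.proj := continuous_fst.comp F.isEmbedding.isEmbedding.continuous
  have hK : IsCompact (Set.range F.proj) := isCompact_range hproj
  have key : (Set.range F.proj ∩ {y | Nonempty (CenteredChart F.emb 3 y)}).Finite := by
    refine hK.induction_on (p := fun s => (s ∩ {y | Nonempty (CenteredChart F.emb 3 y)}).Finite)
      (by simp) (fun s t hst ht => ht.subset (Set.inter_subset_inter_left _ hst))
      (fun s t hs ht => by rw [Set.union_inter_distrib_right]; exact hs.union ht) ?_
    rintro _ ⟨p, rfl⟩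
    rcases F.generic p with ⟨k, ⟨c⟩⟩ | ⟨⟨c⟩⟩
    · refine ⟨c.toHomeo.source,
        mem_nhdsWithin_of_mem_nhds (c.toHomeo.open_source.mem_nhds c.mem_source), ?_⟩
      refine (Set.finite_singleton (F.proj p)).subset ?_
      rintro y ⟨hy, h⟩
      obtain ⟨q, hq, hqy⟩ := exists_three_preimages h
      have hsheet : ∀ i, ∃ j, q i ∈ c.sheet j := fun i => by
        have : q i ∈ ⋃ j, c.sheet j := by
          rw [c.iUnion_sheet]
          change F.proj (q i) ∈ c.toHomeo.source
          rw [hqy]; exact hy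
        exact Set.mem_iUnion.mp this
      choose s hs using hsheet
      have hsinj : Function.Injective fun i => c.coord (s i) := fun i i' hii => by
        have hss : s i = s i' := c.coord.injective hii
        apply hq
        rw [← c.param_proj _ _ (hs i), ← c.param_proj _ _ (hs i')]
        change c.param _ (c.toHomeo (F.proj (q i))) = c.param _ (c.toHomeo (F.proj (q i')))
        rw [hqy, hqy, hss]
      have h0 : c.toHomeo y = 0 := by
        funext m
        obtain ⟨i, rfl⟩ := (Finite.injective_iff_surjective.mp hsinj) m
        have := c.mem_plane _ _ (hs i)
        change c.toHomeo (F.proj (q i)) _ = 0 at this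
        rwa [hqy] at this
      exact c.toHomeo.injOn hy c.mem_source (h0.trans c.map_center.symm)
    · refine ⟨c.toHomeo.source,
        mem_nhdsWithin_of_mem_nhds (c.toHomeo.open_source.mem_nhds c.mem_source), ?_⟩
      refine Set.finite_empty.subset ?_
      rintro y ⟨hy, h⟩
      obtain ⟨q, hq, hqy⟩ := exists_three_preimages h
      have hval : ∀ i, c.toHomeo y =
          ![(c.coords (q i)).1, (c.coords (q i)).2 ^ 2, (c.coords (q i)).1 * (c.coords (q i)).2] :=
        fun i => by
          rw [← c.umbrella, Prod.mk.eta, c.param_coords]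
          · change _ = c.toHomeo (F.proj (q i)); rw [hqy]
          · change F.proj (q i) ∈ _; rw [hqy]; exact hy
      have hinj : ∀ i j, (c.coords (q i)).2 = (c.coords (q j)).2 → i = j := fun i j hij => by
        apply hq
        have hsrc : ∀ i, (F.emb (q i)).1 ∈ c.toHomeo.source := fun i => by
          change F.proj (q i) ∈ _; rw [hqy]; exact hy
        rw [← c.param_coords _ (hsrc i), ← c.param_coords _ (hsrc j)]
        congr 1
        refine Prod.ext ?_ hij
        simpa using congrFun ((hval i).symm.trans (hval j)) 0
      have hsq : ∀ i j, (c.coords (q i)).2 = (c.coords (q j)).2 ∨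
          (c.coords (q i)).2 = -(c.coords (q j)).2 := fun i j => by
        apply sq_eq_sq_iff_eq_or_eq_neg.mp
        simpa using congrFun ((hval i).symm.trans (hval j)) 1
      have h01 := (hsq 0 1).resolve_left fun h => by simpa using hinj _ _ h
      have h02 := (hsq 0 2).resolve_left fun h => by simpa using hinj _ _ h
      have h12 := hinj 1 2 (by linarith)
      simp at h12
  refine (key.subset ?_).to_subtype
  intro y h
  obtain ⟨q, -, hqy⟩ := exists_three_preimages h
  exact ⟨⟨q 0, hqy 0⟩, h⟩

section Quandle

variable {o : SurfaceOrientation M} {X Y : Type*} [Quandle X] [MulAction (AssocGroup X)ᵐᵒᵖ Y]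

/-- The weight `± (r, x₁, x₂, x₃)` of a triple point of an `X_Y`-colored oriented diagram, where
`r` is the label of the region from which all the normal orientations point, and `x₁`, `x₂`, `x₃`
are the labels of the bottom, the middle and the top sheet that face this region. -/
def QColoring.weight (C : F.QColoring o X Y) (τ : F.TriplePt) : QChain X Y 3 :=
  let ε := τ.source o
  let x : Fin 3 → X := fun j => C.label (F.sheetOf (τ.facePt ε j).toSheetPt)
  QuotientAddGroup.mk (τ.sign ε •
    FreeAbelianGroup.of (C.region (F.regionOf (τ.regionPt ε)), ![x 2, x 1, x 0]))

/-- The sum of the weights of all the triple points. -/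
def QColoring.weightSum (C : F.QColoring o X Y) : QChain X Y 3 := ∑ᶠ τ, C.weight τ

end Quandle

section SymQuandle

variable {X Y : Type*} [SymmetricQuandle X] [MulAction (SymAssocGroup X)ᵐᵒᵖ Y]

/-- The label of the semi-sheet of the `j`-th sheet that faces the given region around a triple
point, after a basic inversion if necessary to make its normal orientation point from the
region. -/
def SymAssignment.labelFrom (a : F.SymAssignment X Y) (τ : F.TriplePt) (ε : Octant)
    (j : Fin 3) : X :=
  let p := τ.facePt ε j
  if ε.point j * τ.chart.dside j (F.proj p.1) (a.normal p) < 0 then a.label (F.semiOf p)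
  else SymmetricQuandle.rho (a.label (F.semiOf p))

/-- The weight `± (r, x₁, x₂, x₃)` of a triple point for the specified region `ε`, where `r` is the
label of this region, and `x₁`, `x₂`, `x₃` are the labels of the bottom, the middle and the top
semi-sheet that face it, with the normal orientations that point from it. -/
def SymAssignment.weight (a : F.SymAssignment X Y) (τ : F.TriplePt) (ε : Octant) :
    SQChain X Y 3 :=
  QuotientAddGroup.mk (τ.sign ε • FreeAbelianGroup.of (a.region (F.regionOf (τ.regionPt ε)),
    ![a.labelFrom τ ε 2, a.labelFrom τ ε 1, a.labelFrom τ ε 0]))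

theorem SymAssignment.labelFrom_eq_of_inverted {a b : F.SymAssignment X Y} (h : a.Inverted b)
    (τ : F.TriplePt) (ε : Octant) (j : Fin 3) : a.labelFrom τ ε j = b.labelFrom τ ε j := by
  have hne : ε.point j * τ.chart.dside j (F.proj (τ.facePt ε j).1) (a.normal (τ.facePt ε j)) ≠ 0 :=
    mul_ne_zero (ε.point_ne_zero j)
      (dside_ne_zero τ.chart.toSheetChart (τ.facePt_mem ε j) (a.isUnitNormal _))
  simp only [SymAssignment.labelFrom]
  rcases h.2 (τ.facePt ε j) with ⟨h1, h2⟩ | ⟨h1, h2⟩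
  · rw [h1, h2]
  · rw [h1, h2, SymmetricQuandle.rho_rho, dside_neg, mul_neg]
    rcases lt_or_gt_of_ne hne with h | h
    · rw [if_pos h, if_neg (by linarith)]
    · rw [if_neg h.not_gt, if_pos (by linarith)]

theorem SymAssignment.weight_eq_of_inverted {a b : F.SymAssignment X Y} (h : a.Inverted b)
    (τ : F.TriplePt) (ε : Octant) : a.weight τ ε = b.weight τ ε := by
  simp only [SymAssignment.weight, labelFrom_eq_of_inverted h, h.1]

/-- The weight of a triple point of an `(X, ρ)_Y`-colored diagram for the specified region `ε`. -/
def SymColoring.weight (C : F.SymColoring X Y) (τ : F.TriplePt) (ε : Octant) : SQChain X Y 3 :=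
  Quotient.lift (fun a : F.SymAssignment X Y => a.weight τ ε)
    (fun _ _ h => SymAssignment.weight_eq_of_inverted h τ ε) C

/-- The sum of the weights of all the triple points, where `γ` chooses the specified region of each
of them. -/
def SymColoring.weightSum (C : F.SymColoring X Y) (γ : F.TriplePt → Octant) : SQChain X Y 3 :=
  ∑ᶠ τ, C.weight τ (γ τ)

end SymQuandle

/-! ### Canonical forms and orientation classes of colorings by the symmetric double -/

section CanonicalForm

variable {X Y : Type*} [Quandle X] [MulAction (AssocGroup X)ᵐᵒᵖ Y]

/-- The normal orientations of the canonical form, in which all the labels lie in `X⁺¹`, of the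
`(D_X, ρ)_Y`-coloring represented by an assignment. -/
def SymAssignment.canonicalNormal (a : F.SymAssignment (Double X) Y) (p : F.SemiPt) : R3 :=
  if (a.label (F.semiOf p)).pos then a.normal p else -a.normal p

theorem SymAssignment.canonicalNormal_eq_of_inverted {a b : F.SymAssignment (Double X) Y}
    (h : a.Inverted b) : a.canonicalNormal = b.canonicalNormal := by
  funext p
  rcases h.2 p with ⟨h1, h2⟩ | ⟨h1, h2⟩
  · simp only [canonicalNormal, h1, h2]
  · cases hp : (a.label (F.semiOf p)).pos <;>
      simp [canonicalNormal, h1, h2, hp, SymmetricQuandle.rho]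

/-- The normal orientations of the canonical form of a `(D_X, ρ)_Y`-coloring. -/
def SymColoring.canonicalNormal (C : F.SymColoring (Double X) Y) : F.SemiPt → R3 :=
  Quotient.lift SymAssignment.canonicalNormal
    (fun _ _ h => SymAssignment.canonicalNormal_eq_of_inverted h) C

variable (F X Y) in
/-- Orientation equivalence of `(D_X, ρ)_Y`-colorings: the orientations induced by the canonical
forms coincide.  As an orientation and the normal orientations that represent it determine each
other, this says that the normal orientations of the canonical forms coincide. -/
def oriSetoid : Setoid (F.SymColoring (Double X) Y) :=
  Setoid.ker SymColoring.canonicalNormal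

variable (F X Y) in
/-- The set of orientation equivalence classes of `(D_X, ρ)_Y`-colorings. -/
def OriClass : Type _ := Quotient (oriSetoid F X Y)

/-- The orientation equivalence class `[C]_ori`. -/
def SymColoring.oriClass (C : F.SymColoring (Double X) Y) : F.OriClass X Y :=
  Quotient.mk (oriSetoid F X Y) C

/-- The normal orientations of the canonical forms of the colorings in a class. -/
def OriClass.canonicalNormal (c : F.OriClass X Y) : F.SemiPt → R3 :=
  Quotient.lift SymColoring.canonicalNormal (fun _ _ h => h) c

/-- The orientation `o` is the one induced by the canonical forms of the colorings in the class:
on every semi-sheet, the normal orientation of the canonical form represents `o`. -/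
def OriClass.Induces (c : F.OriClass X Y) (o : SurfaceOrientation M) : Prop :=
  ∀ p : F.SemiPt, F.IsNormal o p.1 (c.canonicalNormal p)

end CanonicalForm

end SurfaceDiagram

end Charts

/-- The multi-sets `{f i | i ∈ I}` and `{g j | j ∈ J}`, in which elements may occur infinitely often,
are equal: every value occurs with the same multiplicity, that is, there is a bijection of the
index sets that matches the values. -/
def MultisetEq {I J A : Type*} (f : I → A) (g : J → A) : Prop :=
  ∃ e : I ≃ J, ∀ i, g (e i) = f i

namespace SurfaceDiagram

variable {M : Type*} [TopologicalSpace M] [ChartedSpace (EuclideanSpace ℝ (Fin 2)) M]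
  [IsManifold (𝓡 2) ∞ M] (F : SurfaceDiagram M)
  {X Y A : Type*} [Quandle X] [MulAction (AssocGroup X)ᵐᵒᵖ Y] [AddCommGroup A]

/-- The quandle cocycle invariant of the oriented diagram `(F, o)`, as the family of the values
`θ(W(C))` indexed by the `X_Y`-colorings `C`. -/
def cocycleInvariant (o : SurfaceOrientation M) (θ : QChain X Y 3 →+ A) :
    F.QColoring o X Y → A :=
  fun C => θ C.weightSum

/-- The symmetric quandle cocycle invariant of the diagram restricted to an orientation
equivalence class `c`, as the family of the values `θ(W(C))` indexed by the colorings `C` in the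
class.  The map `γ` chooses the specified regions of the triple points. -/
def symCocycleInvariant (c : F.OriClass X Y) (θ : SQChain (Double X) Y 3 →+ A)
    (γ : F.TriplePt → Octant) : {C : F.SymColoring (Double X) Y // C.oriClass = c} → A :=
  fun C => θ (C.1.weightSum γ)

end SurfaceDiagram

end SymDouble

end

open SymDouble

open scoped Manifold ContDiff Topology Quandles

noncomputable section

namespace SymDouble

/-! An `X_Y`-coloring of the oriented diagram is the same thing as the canonical form of a coloring
by the double. The sheet labels, restricted to semi-sheets, become positive labels, and the normals
representing `o` become the normal field. Conversely, forgetting the signs in a coloring of the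
class leaves labels in `X` on semi-sheets that do not change across an over-sheet's double curves,
hence labels of sheets. This gives the bijection `toOriClass_bijective`. It has two geometric
inputs. The normals representing `o` are coherent along every sheet of a chart
(`dside_mul_dside_pos`), so the incoherent cases of the coloring conditions never occur. A function
on semi-sheets that agrees across the double curves of over-sheets descends to sheets
(`label_eq_of_sheetOf_eq`).

The bijection matches values because it matches weights, triple point by triple point. Moving the
specified region across one sheet reverses the sign of the triple point and applies `flipAt` to the
tuple, so the class modulo `symDegenerate` is unchanged (`weight_eq`). The specified region may
therefore be the one from which all normals representing `o` point. There every label is positive,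
canonicalization does nothing, and `doubleToQ` returns the weight of the `X_Y`-coloring
(`doubleToQ_weight`). Compactness makes the set of triple points finite, so `doubleToQ` passes
through the sum, and θQ ∘ T₃ = θSQ concludes.

Sides and coherence are expressed throughout by signs of products of real numbers, whence the sign
lemmas. -/

theorem mul_pos_trans {a b c : ℝ} (h₁ : 0 < a * b) (h₂ : 0 < b * c) : 0 < a * c := by
  have h : 0 < b ^ 2 * (a * c) := by
    rw [show b ^ 2 * (a * c) = a * b * (b * c) by ring]
    exact mul_pos h₁ h₂
  exact pos_of_mul_pos_right h (sq_nonneg b)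

/-! ### Triples of vectors of `ℝ³` -/

theorem det_smul_third (a b c : R3) (t : ℝ) :
    (Matrix.of ![a, b, t • c]).det = t * (Matrix.of ![a, b, c]).det := by
  simp [Matrix.det_fin_three]; ring

theorem exists_orthogonal_of_det_eq_zero {a b c : R3} (h : (Matrix.of ![a, b, c]).det = 0) :
    ∃ x : R3, x ≠ 0 ∧ a ⬝ᵥ x = 0 ∧ b ⬝ᵥ x = 0 ∧ c ⬝ᵥ x = 0 := by
  obtain ⟨x, hx, h0⟩ := Matrix.exists_mulVec_eq_zero_iff.mpr h
  exact ⟨x, hx, congrFun h0 0, congrFun h0 1, congrFun h0 2⟩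

theorem det_update_neg (w : Fin 3 → R3) (j : Fin 3) :
    (Matrix.of ![Function.update w j (-w j) 0, Function.update w j (-w j) 1,
      Function.update w j (-w j) 2]).det = -(Matrix.of ![w 0, w 1, w 2]).det := by
  fin_cases j <;> simp [Matrix.det_fin_three] <;> ring

theorem dotProduct_self_pos {x : R3} (hx : x ≠ 0) : 0 < x ⬝ᵥ x :=
  lt_of_le_of_ne (Finset.sum_nonneg fun _ _ => mul_self_nonneg _)
    fun h => hx (dotProduct_self_eq_zero.mp h.symm)

namespace SurfaceDiagram

variable {M : Type*} [TopologicalSpace M] [ChartedSpace (EuclideanSpace ℝ (Fin 2)) M]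
  [IsManifold (𝓡 2) ∞ M] {F : SurfaceDiagram M}

set_option linter.unusedSectionVars false

/-! ### The projection as a smooth map -/

theorem contMDiff_proj : ContMDiff (𝓡 2) 𝓘(ℝ, R3) ∞ F.proj :=
  contDiff_fst.contMDiff.comp F.isEmbedding.contMDiff

theorem hasMFDerivAt_proj (p : M) : HasMFDerivAt (𝓡 2) 𝓘(ℝ, R3) F.proj p (F.dproj p) :=
  (contMDiff_proj.mdifferentiableAt (by simp)).hasMFDerivAt

theorem continuous_proj : Continuous F.proj := contMDiff_proj.continuous

theorem emb_injective : Function.Injective F.emb := F.isEmbedding.isEmbedding.injective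

theorem isUnitNormal_neg {p : M} {v : R3} (h : F.IsUnitNormal p v) : F.IsUnitNormal p (-v) :=
  ⟨by simpa using h.1, fun w => by simp [h.2 w]⟩

/-! ### Conormal vectors of sheets -/

section Conormal

variable {k : ℕ} (c : SheetChart F.emb k) {j : Fin k} {p : M}

theorem proj_mem_source (hp : p ∈ c.sheet j) : F.proj p ∈ c.toHomeo.source := by
  have : p ∈ ⋃ i, c.sheet i := Set.mem_iUnion.mpr ⟨j, hp⟩
  rw [c.iUnion_sheet] at this
  exact this

/-- The vector that represents the linear form `dside` with respect to the dot product. -/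
def conormal (j : Fin k) (y : R3) : R3 := fun i => c.dside j y (Pi.single i 1)

theorem conormal_dotProduct (j : Fin k) (y v : R3) : conormal c j y ⬝ᵥ v = c.dside j y v := by
  conv_rhs => rw [pi_eq_sum_univ' v]
  simp only [SheetChart.dside, map_sum, map_smul, Finset.sum_apply, Pi.smul_apply, smul_eq_mul,
    dotProduct, conormal]
  refine Finset.sum_congr rfl fun i _ => ?_
  rw [mul_comm]

theorem differentiableAt_toHomeo {y : R3} (hy : y ∈ c.toHomeo.source) :
    DifferentiableAt ℝ c.toHomeo y :=
  (c.smooth.contDiffAt (c.toHomeo.open_source.mem_nhds hy)).differentiableAt (by simp)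

/-- The coordinate across the sheet vanishes identically along the sheet, so the chain rule kills
its derivative in tangent directions. -/
theorem conormal_dotProduct_dproj (hp : p ∈ c.sheet j) (w : TangentSpace (𝓡 2) p) :
    conormal c j (F.proj p) ⬝ᵥ F.dproj p w = 0 := by
  rw [conormal_dotProduct]
  have h1 : HasFDerivAt (fun y => c.toHomeo y (c.coord j))
      ((ContinuousLinearMap.proj (R := ℝ) (φ := fun _ : Fin 3 => ℝ) (c.coord j)).comp
        (fderiv ℝ c.toHomeo (F.proj p))) (F.proj p) :=
    (ContinuousLinearMap.proj (R := ℝ) (φ := fun _ : Fin 3 => ℝ) (c.coord j)).hasFDerivAt.comp _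
      (differentiableAt_toHomeo c (proj_mem_source c hp)).hasFDerivAt
  have h2 := h1.hasMFDerivAt.comp p (hasMFDerivAt_proj p)
  have h3 : HasMFDerivAt (𝓡 2) 𝓘(ℝ, ℝ) ((fun y => c.toHomeo y (c.coord j)) ∘ F.proj) p
      (0 : TangentSpace (𝓡 2) p →L[ℝ] ℝ) := by
    refine (hasMFDerivAt_const (0 : ℝ) p).congr_of_eventuallyEq ?_
    filter_upwards [(c.isOpen_sheet j).mem_nhds hp] with q hq
    exact c.mem_plane j q hq
  have h4 := congrArg (fun L : TangentSpace (𝓡 2) p →L[ℝ] ℝ => L w) (hasMFDerivAt_unique h2 h3)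
  exact h4

/-- A normal vector of a sheet that does not point to any side of it vanishes. -/
theorem eq_zero_of_dside_eq_zero (hp : p ∈ c.sheet j) {x : R3}
    (hx : ∀ w, x ⬝ᵥ F.dproj p w = 0) (h : c.dside j (F.proj p) x = 0) : x = 0 := by
  by_contra h0
  have hpos := dotProduct_self_pos h0
  have hs : 0 < √(x ⬝ᵥ x) := Real.sqrt_pos.mpr hpos
  refine dside_ne_zero c hp (v := (√(x ⬝ᵥ x))⁻¹ • x) ⟨?_, fun w => ?_⟩ ?_
  · rw [smul_dotProduct, dotProduct_smul, smul_eq_mul, smul_eq_mul]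
    -- The third occurrence of `x ⬝ᵥ x` is the one not under a root.
    nth_rewrite 3 [← Real.mul_self_sqrt hpos.le]
    field_simp
  · rw [smul_dotProduct, hx, smul_zero]
  · rw [← conormal_dotProduct, dotProduct_smul, conormal_dotProduct, h, smul_zero]

/-- A vector orthogonal to all three rows would be normal to the sheet and point to neither side,
hence be zero. -/
theorem det_frame_ne_zero (hp : p ∈ c.sheet j)
    (b : Module.Basis (Fin 2) ℝ (TangentSpace (𝓡 2) p)) :
    (Matrix.of ![F.dproj p (b 0), F.dproj p (b 1), conormal c j (F.proj p)]).det ≠ 0 := by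
  intro h
  obtain ⟨x, hx, h0, h1, h2⟩ := exists_orthogonal_of_det_eq_zero h
  refine hx (eq_zero_of_dside_eq_zero c hp (fun w => ?_) (by rwa [← conormal_dotProduct]))
  rw [← b.sum_repr w, Fin.sum_univ_two, map_add, map_smul, map_smul, dotProduct_add,
    dotProduct_smul, dotProduct_smul, dotProduct_comm, h0, dotProduct_comm, h1]
  simp

theorem conormal_ne_zero (hp : p ∈ c.sheet j) : conormal c j (F.proj p) ≠ 0 := by
  intro h
  -- Any basis serves: a zero third row makes the determinant vanish.
  refine det_frame_ne_zero c hp (EuclideanSpace.basisFun (Fin 2) ℝ).toBasis ?_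
  rw [h]
  simp [Matrix.det_fin_three]

/-- The normal space of a sheet is the line spanned by the conormal. The relation is kept free of
division; the difference of the two sides is a normal vector with zero `dside`. -/
theorem smul_eq_smul_conormal (hp : p ∈ c.sheet j) {v : R3} (hv : ∀ w, v ⬝ᵥ F.dproj p w = 0) :
    (conormal c j (F.proj p) ⬝ᵥ conormal c j (F.proj p)) • v =
      c.dside j (F.proj p) v • conormal c j (F.proj p) := by
  rw [← sub_eq_zero]
  refine eq_zero_of_dside_eq_zero c hp (fun w => ?_) ?_
  · rw [sub_dotProduct, smul_dotProduct, smul_dotProduct, hv, conormal_dotProduct_dproj c hp]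
    simp
  · rw [← conormal_dotProduct, dotProduct_sub, dotProduct_smul, dotProduct_smul,
      ← conormal_dotProduct]
    simp only [smul_eq_mul]
    ring

/-- There is only one unit normal vector that points to a given side of a sheet. -/
theorem isUnitNormal_unique (hp : p ∈ c.sheet j) {v v' : R3} (hv : F.IsUnitNormal p v)
    (hv' : F.IsUnitNormal p v')
    (h : 0 < c.dside j (F.proj p) v * c.dside j (F.proj p) v') : v = v' := by
  have hl := dotProduct_self_pos (conormal_ne_zero c hp)
  have e := smul_eq_smul_conormal c hp hv.2
  have e' := smul_eq_smul_conormal c hp hv'.2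
  -- Taking squared lengths in `e` and `e'` shows that both values of `dside` have the square `l ⬝ᵥ
  -- l`, where `l` is the conormal; the sign hypothesis excludes opposite roots.
  have d : c.dside j (F.proj p) v = c.dside j (F.proj p) v' := by
    have n := congrArg (fun x => x ⬝ᵥ x) e
    have n' := congrArg (fun x => x ⬝ᵥ x) e'
    simp only [smul_dotProduct, dotProduct_smul, smul_eq_mul, hv.1, hv'.1] at n n'
    have hsq : c.dside j (F.proj p) v ^ 2 = c.dside j (F.proj p) v' ^ 2 :=
      mul_right_cancel₀ hl.ne' (by linarith)
    rcases sq_eq_sq_iff_eq_or_eq_neg.mp hsq with h1 | h1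
    · exact h1
    · rw [h1] at h
      nlinarith [sq_nonneg (c.dside j (F.proj p) v')]
  rw [d, ← e'] at e
  exact smul_right_injective _ hl.ne' e

/-- There is a unit normal vector that points to a given side of a sheet. -/
theorem exists_isUnitNormal (hp : p ∈ c.sheet j) {s : ℝ} (hs : s ≠ 0) :
    ∃ v, F.IsUnitNormal p v ∧ 0 < s * c.dside j (F.proj p) v := by
  set l := conormal c j (F.proj p) with hl
  have hpos := dotProduct_self_pos (conormal_ne_zero c hp)
  rw [← hl] at hpos
  have hsq : 0 < √(l ⬝ᵥ l) := Real.sqrt_pos.mpr hpos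
  have key : F.IsUnitNormal p ((√(l ⬝ᵥ l))⁻¹ • l) := by
    refine ⟨?_, fun w => ?_⟩
    · rw [smul_dotProduct, dotProduct_smul, smul_eq_mul, smul_eq_mul]
      nth_rewrite 3 [← Real.mul_self_sqrt hpos.le]
      field_simp
    · rw [smul_dotProduct, conormal_dotProduct_dproj c hp, smul_zero]
  have hd : 0 < c.dside j (F.proj p) ((√(l ⬝ᵥ l))⁻¹ • l) := by
    rw [← conormal_dotProduct, dotProduct_smul, smul_eq_mul]
    positivity
  rcases lt_or_gt_of_ne hs with h | h
  · exact ⟨_, isUnitNormal_neg key, by rw [dside_neg]; nlinarith⟩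
  · exact ⟨_, key, mul_pos h hd⟩

end Conormal

/-! ### Normal vectors that represent an orientation -/

section Orientation

variable {k : ℕ} (c : SheetChart F.emb k) {j : Fin k} {p : M} {o : SurfaceOrientation M}

/-- The normal is proportional to the conormal with a factor of the sign of `dside`. The side of the
normal can thus be read off from a determinant that does not involve the normal and varies
continuously with the point. -/
theorem dside_mul_det_frame_pos (hp : p ∈ c.sheet j) {v : R3} (hv : F.IsNormal o p v)
    (b : Module.Basis (Fin 2) ℝ (TangentSpace (𝓡 2) p)) (hb : b.orientation = o.orient p) :
    0 < c.dside j (F.proj p) v *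
      (Matrix.of ![F.dproj p (b 0), F.dproj p (b 1), conormal c j (F.proj p)]).det := by
  rw [← det_smul_third, ← smul_eq_smul_conormal c hp hv.1.2, det_smul_third]
  exact mul_pos (dotProduct_self_pos (conormal_ne_zero c hp)) (hv.2 b hb)

theorem exists_basis (o : SurfaceOrientation M) (p : M) :
    ∃ b : Module.Basis (Fin 2) ℝ (TangentSpace (𝓡 2) p), b.orientation = o.orient p := by
  obtain ⟨U, hU, e, -, h⟩ := o.continuous p
  obtain ⟨b, -, hb⟩ := h p (mem_of_mem_nhds hU)
  exact ⟨b, hb⟩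

theorem det_change_basis (b b' : Module.Basis (Fin 2) ℝ (TangentSpace (𝓡 2) p)) (v : R3) :
    (Matrix.of ![F.dproj p (b' 0), F.dproj p (b' 1), v]).det =
      b.det b' * (Matrix.of ![F.dproj p (b 0), F.dproj p (b 1), v]).det := by
  have h : ∀ i, F.dproj p (b' i) = b.toMatrix b' 0 i • F.dproj p (b 0) +
      b.toMatrix b' 1 i • F.dproj p (b 1) := fun i => by
    rw [← b.sum_toMatrix_smul_self b' i, Fin.sum_univ_two, map_add, map_smul, map_smul]
  rw [h 0, h 1, Module.Basis.det_apply, Matrix.det_fin_two]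
  simp [Matrix.det_fin_three]
  ring

/-- The sign of the determinant of a positive frame with the conormal tells which of the two unit
normals is right-handed. A change of positive basis multiplies the determinant by a positive factor.
-/
theorem exists_isNormal (hp : p ∈ c.sheet j) : ∃ v, F.IsNormal o p v := by
  obtain ⟨b, hb⟩ := exists_basis o p
  obtain ⟨v, hv, h⟩ := exists_isUnitNormal c hp (det_frame_ne_zero c hp b)
  refine ⟨v, hv, fun b' hb' => ?_⟩
  rw [RightHanded, det_change_basis b b' v]
  refine mul_pos ((b.orientation_eq_iff_det_pos b').mp (hb.trans hb'.symm)) ?_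
  rw [mul_comm, ← det_smul_third, ← smul_eq_smul_conormal c hp hv.2, det_smul_third] at h
  exact pos_of_mul_pos_right h (dotProduct_self_pos (conormal_ne_zero c hp)).le

/-- Convexity of the chart's target enters here: the sheet is the continuous image of a convex piece
of a plane. -/
theorem isPreconnected_sheet (j : Fin k) : IsPreconnected (c.sheet j) := by
  have h : c.sheet j = c.param j '' {x | x ∈ c.toHomeo.target ∧ x (c.coord j) = 0} := by
    refine Set.Subset.antisymm (fun q hq => ?_) ?_
    · exact ⟨c.toHomeo (F.proj q), ⟨c.toHomeo.map_source (proj_mem_source c hq),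
        c.mem_plane j q hq⟩, c.param_proj j q hq⟩
    · rintro _ ⟨x, ⟨h1, h2⟩, rfl⟩
      exact c.param_mem j x h1 h2
  rw [h]
  refine IsPreconnected.image (Convex.isPreconnected ?_) _ (c.smooth_param j).continuousOn
  refine c.convex_target.inter (t := {x : R3 | x (c.coord j) = 0}) ?_
  intro x hx y hy a b _ _ _
  simp only [Set.mem_ofPred_eq] at hx hy
  simp [hx, hy]

theorem continuousAt_conormal (hp : p ∈ c.sheet j) :
    ContinuousAt (fun q => conormal c j (F.proj q)) p := by
  have h1 : ContinuousAt (fderiv ℝ c.toHomeo) (F.proj p) :=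
    (c.smooth.contDiffAt (c.toHomeo.open_source.mem_nhds (proj_mem_source c hp))).continuousAt_fderiv
      (by simp)
  have h2 : ContinuousAt (fun q => fderiv ℝ c.toHomeo (F.proj q)) p :=
    ContinuousAt.comp (g := fderiv ℝ c.toHomeo) h1 continuous_proj.continuousAt
  refine continuousAt_pi.mpr fun i => ?_
  exact (continuous_apply (c.coord j)).continuousAt.comp
    (f := fun q => fderiv ℝ c.toHomeo (F.proj q) (Pi.single i 1))
    (h2.clm_apply continuousAt_const)

/-- The tangent map of the projection is continuous, and so is the vector component on the trivial
tangent bundle of `R3`. -/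
theorem continuousAt_dproj {e : ∀ q : M, TangentSpace (𝓡 2) q} {U : Set M} (hU : U ∈ 𝓝 p)
    (he : ContinuousOn (fun q => (⟨q, e q⟩ : TangentBundle (𝓡 2) M)) U) :
    ContinuousAt (fun q => F.dproj q (e q)) p := by
  have h1 : Continuous fun z : TangentBundle 𝓘(ℝ, R3) R3 => (z.2 : R3) :=
    (contMDiff_snd_tangentBundle_modelSpace R3 𝓘(ℝ, R3) (n := 0)).continuous
  have h2 : Continuous (tangentMap (𝓡 2) 𝓘(ℝ, R3) F.proj) :=
    contMDiff_proj.continuous_tangentMap (by simp)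
  exact ((h1.comp h2).comp_continuousOn he).continuousAt hU

/-- The normal vectors that represent an orientation point to the same side at all the points of
a sheet of a chart. -/
theorem dside_mul_dside_pos {q : M} (hp : p ∈ c.sheet j) (hq : q ∈ c.sheet j) {v w : R3}
    (hv : F.IsNormal o p v) (hw : F.IsNormal o q w) :
    0 < c.dside j (F.proj p) v * c.dside j (F.proj q) w := by
  let P : M → M → Prop := fun p q => p ∈ c.sheet j → q ∈ c.sheet j → ∀ v w, F.IsNormal o p v →
    F.IsNormal o q w → 0 < c.dside j (F.proj p) v * c.dside j (F.proj q) w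
  suffices P p q from this hp hq v w hv hw
  -- On a preconnected set it suffices that the relation holds near the diagonal, is transitive and
  -- is symmetric.
  refine (isPreconnected_sheet c j).induction₂ P ?_ ?_ ?_ hp hq
  · intro p hp
    obtain ⟨U, hU, e, he, hb⟩ := o.continuous p
    -- With a continuous positive frame this determinant is continuous and nonzero at `p`, so it
    -- keeps its sign nearby; its sign is the side of the normal.
    have hD : ContinuousAt (fun q => (Matrix.of ![F.dproj q (e 0 q), F.dproj q (e 1 q),
        conormal c j (F.proj q)]).det) p := by
      have h0 := continuousAt_dproj (F := F) hU (he 0)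
      have h1 := continuousAt_dproj (F := F) hU (he 1)
      have h2 := continuousAt_conormal c hp
      have h0' := fun i => continuousAt_pi.mp h0 i
      have h1' := fun i => continuousAt_pi.mp h1 i
      have h2' := fun i => continuousAt_pi.mp h2 i
      simp only [Matrix.det_fin_three, Matrix.of_apply, Matrix.cons_val]
      fun_prop (disch := assumption)
    obtain ⟨b, hbe, hbo⟩ := hb p (mem_of_mem_nhds hU)
    have hne := det_frame_ne_zero c hp b
    rw [hbe, hbe] at hne
    have hev := (hD.mul continuousAt_const).eventually_const_lt (mul_self_pos.mpr hne)
    filter_upwards [mem_nhdsWithin_of_mem_nhds hev, mem_nhdsWithin_of_mem_nhds hU]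
      with q h1 hqU _ hq v w hv hw
    obtain ⟨b', hbe', hbo'⟩ := hb q hqU
    have h2 := dside_mul_det_frame_pos c hp hv b hbo
    have h3 := dside_mul_det_frame_pos c hq hw b' hbo'
    rw [hbe, hbe] at h2
    rw [hbe', hbe'] at h3
    rw [Pi.mul_apply, mul_comm] at h1
    rw [mul_comm] at h3
    exact mul_pos_trans (mul_pos_trans h2 h1) h3
  · intro x y z _ hy _ hxy hyz hx hz v w hv hw
    -- The relation quantifies over all normals, so transitivity needs an actual one at the middle
    -- point.
    obtain ⟨u, hu⟩ := exists_isNormal (o := o) c hy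
    exact mul_pos_trans (hxy hx hy v u hv hu) (hyz hy hz u w hu hw)
  · intro x y _ _ h hy hx v w hv hw
    rw [mul_comm]
    exact h hx hy w v hw hv

end Orientation

end SurfaceDiagram

end SymDouble

namespace SymDouble

namespace SurfaceDiagram

variable {M : Type*} [TopologicalSpace M] [ChartedSpace (EuclideanSpace ℝ (Fin 2)) M]
  [IsManifold (𝓡 2) ∞ M] {F : SurfaceDiagram M}

set_option linter.unusedSectionVars false

/-! ### Restrictions of charts -/

/-- The restriction of a chart to a convex open set that meets only some of the sheets. -/
def restrictChart {k m : ℕ} (c : SheetChart F.emb k) (σ : Fin m → Fin k) (hσ : StrictMono σ)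
    (U : Set R3) (hU : IsOpen U) (hconv : Convex ℝ U)
    (h : ∀ i, i ∉ Set.range σ → ∀ x ∈ U, x (c.coord i) ≠ 0) : SheetChart F.emb m where
  toHomeo := c.toHomeo.trans (OpenPartialHomeomorph.ofSet U hU)
  smooth := c.smooth.mono fun y hy => by simp at hy; exact hy.1
  smooth_symm := c.smooth_symm.mono fun y hy => by simp at hy; exact hy.2
  convex_target := by
    have : (c.toHomeo.trans (OpenPartialHomeomorph.ofSet U hU)).target =
        U ∩ c.toHomeo.target := by ext; simp
    rw [this]
    exact hconv.inter c.convex_target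
  coord := ⟨c.coord ∘ σ, c.coord.injective.comp hσ.injective⟩
  sheet j := c.sheet (σ j) ∩ {p | c.toHomeo (F.proj p) ∈ U}
  param j := c.param (σ j)
  isOpen_sheet j := by
    have hc : ContinuousOn (fun p => c.toHomeo (F.proj p)) (c.sheet (σ j)) :=
      c.toHomeo.continuousOn.comp continuous_proj.continuousOn
        fun p hp => proj_mem_source c hp
    exact hc.isOpen_inter_preimage (c.isOpen_sheet _) hU
  disjoint_sheet i j hij := (c.disjoint_sheet _ _ (hσ.injective.ne hij)).mono
    Set.inter_subset_left Set.inter_subset_left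
  iUnion_sheet := by
    ext p
    constructor
    · intro hp
      obtain ⟨j, h1, h2⟩ := Set.mem_iUnion.mp hp
      simpa using ⟨proj_mem_source c h1, h2⟩
    · intro hp
      obtain ⟨h1, h2⟩ : (F.emb p).1 ∈ c.toHomeo.source ∧ c.toHomeo (F.emb p).1 ∈ U := by
        simpa using hp
      have h3 : p ∈ ⋃ j, c.sheet j := by rw [c.iUnion_sheet]; exact h1
      obtain ⟨i, hi⟩ := Set.mem_iUnion.mp h3
      by_cases hr : i ∈ Set.range σ
      · obtain ⟨j, rfl⟩ := hr
        exact Set.mem_iUnion.mpr ⟨j, hi, h2⟩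
      · exact absurd (c.mem_plane i p hi) (h i hr _ h2)
  mem_plane j p hp := c.mem_plane _ p hp.1
  param_mem j x hx h0 := by
    obtain ⟨h1, h2⟩ : x ∈ U ∧ x ∈ c.toHomeo.target := by simpa using hx
    refine ⟨c.param_mem _ x h2 h0, ?_⟩
    change c.toHomeo (F.emb _).1 ∈ U
    rw [c.proj_param _ x h2 h0]
    exact h1
  proj_param j x hx h0 := by
    obtain ⟨h1, h2⟩ : x ∈ U ∧ x ∈ c.toHomeo.target := by simpa using hx
    exact c.proj_param _ x h2 h0
  param_proj j p hp := c.param_proj _ p hp.1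
  smooth_param j := (c.smooth_param (σ j)).mono fun x hx => by
    obtain ⟨h1, h2⟩ : x ∈ U ∧ x ∈ c.toHomeo.target := by simpa using hx.1
    exact ⟨h2, hx.2⟩
  above i j hij p hp q hq := c.above _ _ (hσ hij) p hp.1 q hq.1

/-- The factor `s` selects the side by its sign, so both half-spaces are covered at once. -/
theorem isOpen_halfSpace (s : ℝ) (i : Fin 3) : IsOpen {x : R3 | 0 < s * x i} :=
  isOpen_lt continuous_const (continuous_const.mul (continuous_apply i))

theorem convex_halfSpace (s : ℝ) (i : Fin 3) : Convex ℝ {x : R3 | 0 < s * x i} := by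
  have : IsLinearMap ℝ fun x : R3 => s * x i :=
    ⟨fun x y => by simp [mul_add], fun a x => by simp; ring⟩
  exact convex_halfSpace_gt this 0

theorem strictMono_pair {k : ℕ} {i j : Fin k} (h : i < j) : StrictMono ![i, j] := by
  intro a b hab
  fin_cases a <;> fin_cases b <;> simp_all

theorem strictMono_single {k : ℕ} (i : Fin k) : StrictMono ![i] := fun a b hab => by
  exact absurd (Subsingleton.elim a b) hab.ne

/-! ### Sheets and semi-sheets inside charts -/

theorem component_eq_of_isPreconnected {T S : Set M} (hS : IsPreconnected S) (hT : S ⊆ T)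
    (p q : T) (hp : p.1 ∈ S) (hq : q.1 ∈ S) :
    (ConnectedComponents.mk p) = ConnectedComponents.mk q := by
  have h : IsPreconnected ((↑) ⁻¹' S : Set T) := by
    rw [← Topology.IsInducing.subtypeVal.isPreconnected_image, Subtype.image_preimage_coe,
      Set.inter_eq_right.mpr hT]
    exact hS
  exact ConnectedComponents.coe_eq_coe'.mpr (h.subset_connectedComponent hq hp)

theorem eq_of_mem_sheet {k : ℕ} (c : SheetChart F.emb k) {j : Fin k} {p q : M}
    (hp : p ∈ c.sheet j) (hq : q ∈ c.sheet j) (h : F.proj p = F.proj q) : p = q := by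
  rw [← c.param_proj j p hp, ← c.param_proj j q hq]
  change c.param j (c.toHomeo (F.proj p)) = c.param j (c.toHomeo (F.proj q))
  rw [h]

/-- The sheet numbered `0` is open, and every other point of the surface over it lies on a sheet of
the same chart that is below it. -/
theorem notMem_closure_lowerSet {k : ℕ} (c : SheetChart F.emb (k + 1)) {p : M}
    (hp : p ∈ c.sheet 0) : p ∉ closure F.lowerSet := by
  intro hcl
  obtain ⟨q, hq, q', h1, h2⟩ := mem_closure_iff.mp hcl _ (c.isOpen_sheet 0) hp
  have hs : q' ∈ ⋃ i, c.sheet i := by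
    rw [c.iUnion_sheet]
    change F.proj q' ∈ c.toHomeo.source
    rw [h1]
    exact proj_mem_source c hq
  obtain ⟨i, hi⟩ := Set.mem_iUnion.mp hs
  rcases eq_or_ne i 0 with rfl | h0
  · rw [eq_of_mem_sheet c hi hq h1] at h2
    exact lt_irrefl _ h2
  · exact lt_asymm h2 (c.above 0 i (Fin.pos_of_ne_zero h0) q hq q' hi h1.symm)

/-- The top sheet of a chart is never cut, whatever passes below it. The analogue for semi-sheets
needs a chart with a single sheet. -/
theorem sheetOf_eq {k : ℕ} (c : SheetChart F.emb (k + 1)) (p q : F.SheetPt)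
    (hp : p.1 ∈ c.sheet 0) (hq : q.1 ∈ c.sheet 0) : F.sheetOf p = F.sheetOf q :=
  component_eq_of_isPreconnected (isPreconnected_sheet c 0)
    (fun _ hx => notMem_closure_lowerSet c hx) p q hp hq

theorem semiOf_eq (c : SheetChart F.emb 1) (p q : F.SemiPt)
    (hp : p.1 ∈ c.sheet 0) (hq : q.1 ∈ c.sheet 0) : F.semiOf p = F.semiOf q :=
  component_eq_of_isPreconnected (isPreconnected_sheet c 0)
    (fun _ hx => notMem_closure_doubleSet c hx fun i hi => absurd (Subsingleton.elim i 0) hi)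
    p q hp hq

/-- Otherwise `param i` would supply a second preimage of the same point of `ℝ³`, on a disjoint
sheet. -/
theorem side_ne_zero {k : ℕ} (c : SheetChart F.emb k) {i j : Fin k} (p : F.SemiPt)
    (hp : p.1 ∈ c.sheet j) (hij : i ≠ j) : c.side i (F.proj p.1) ≠ 0 := by
  intro h0
  have ht := c.toHomeo.map_source (proj_mem_source c hp)
  refine p.2 (subset_closure ⟨c.param i (c.toHomeo (F.proj p.1)), fun h => ?_, ?_⟩)
  · have := c.param_mem i _ ht h0
    rw [h] at this
    exact Set.disjoint_left.mp (c.disjoint_sheet i j hij) this hp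
  · exact c.toHomeo.injOn (proj_mem_source c (c.param_mem i _ ht h0)) (proj_mem_source c hp)
      (c.proj_param i _ ht h0)

/-- A branch point belongs to the closure of the set of lower points. -/
theorem branch_mem_closure_lowerSet {p : M} (c : BranchChart F.emb (F.proj p)) :
    p ∈ closure F.lowerSet := by
  have hp : c.param (0, 0) = p := by
    have h1 : c.toHomeo (F.proj p) = ![(c.coords p).1, (c.coords p).2 ^ 2,
        (c.coords p).1 * (c.coords p).2] := by
      rw [← c.umbrella, Prod.mk.eta, c.param_coords p c.mem_source]
      rfl
    rw [c.map_center] at h1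
    have h2 : (c.coords p).1 = 0 := by simpa using (congrFun h1 0).symm
    have h3 : (c.coords p).2 = 0 := by simpa using (congrFun h1 1).symm
    refine Eq.trans ?_ (c.param_coords p c.mem_source)
    congr 1
    exact Prod.ext h2.symm h3.symm
  -- The line `u = 0` is folded onto the double curve of the umbrella.
  have hproj : ∀ v : ℝ, F.proj (c.param (0, v)) = F.proj (c.param (0, -v)) := fun v =>
    c.toHomeo.injOn (c.param_mem _) (c.param_mem _) (by
      change c.toHomeo (F.emb _).1 = c.toHomeo (F.emb _).1
      rw [c.umbrella, c.umbrella]; simp)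
  -- The two points have different heights because the surface is embedded.
  have hlow : ∀ v : ℝ, v ≠ 0 → c.param (0, v) ∈ F.lowerSet ∨ c.param (0, -v) ∈ F.lowerSet := by
    intro v hv
    rcases lt_trichotomy (F.emb (c.param (0, v))).2 (F.emb (c.param (0, -v))).2 with h | h | h
    · exact Or.inl ⟨_, (hproj v).symm, h⟩
    · exfalso
      have h1 := congrArg c.coords (emb_injective (Prod.ext (hproj v) h))
      rw [c.coords_param, c.coords_param] at h1
      have h2 := congrArg Prod.snd h1
      simp only at h2
      exact hv (by linarith)
    · exact Or.inr ⟨_, hproj v, h⟩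
  -- Only one of the points `(0, v)` and `(0, -v)` is known to be lower, so both must be close to
  -- `p`; this is used for `s = 1` and `s = -1`.
  have hcont : ∀ s : ℝ, Filter.Tendsto (fun v : ℝ => c.param (0, s * v)) (𝓝[≠] 0) (𝓝 p) := by
    intro s
    have : Continuous fun v : ℝ => c.param (0, s * v) :=
      c.smooth_param.continuous.comp (by fun_prop)
    have h := this.tendsto 0
    simp only [mul_zero, hp] at h
    exact h.mono_left nhdsWithin_le_nhds
  rw [mem_closure_iff_nhds]
  intro U hU
  have h1 := (hcont 1).eventually_mem hU
  have h2 := (hcont (-1)).eventually_mem hU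
  obtain ⟨v, ⟨h1, h2⟩, hv⟩ := ((h1.and h2).and self_mem_nhdsWithin).exists
  simp only [one_mul, neg_mul] at h1 h2
  rcases hlow v hv with h | h
  · exact ⟨_, h1, h⟩
  · exact ⟨_, h2, h⟩

/-- Branch points are excluded, being limits of lower points. On any sheet but the top one, the
point of the top sheet over the centre would make `p` a lower point. -/
theorem exists_chart (p : F.SheetPt) :
    ∃ (k : ℕ) (c : CenteredChart F.emb (k + 1) (F.proj p.1)), p.1 ∈ c.sheet 0 := by
  rcases F.generic p.1 with ⟨k, ⟨c⟩⟩ | ⟨⟨c⟩⟩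
  · have hs : p.1 ∈ ⋃ i, c.sheet i := by
      rw [c.iUnion_sheet]
      exact c.mem_source
    obtain ⟨j, hj⟩ := Set.mem_iUnion.mp hs
    obtain _ | k := k
    · exact j.elim0
    refine ⟨k, c, ?_⟩
    rcases eq_or_ne j 0 with rfl | h0
    · exact hj
    · exfalso
      have ht : (0 : R3) ∈ c.toHomeo.target := by rw [c.target_eq]; trivial
      have hm := c.param_mem 0 0 ht rfl
      have he : F.proj (c.param 0 0) = F.proj p.1 :=
        c.toHomeo.injOn (proj_mem_source c.toSheetChart hm) c.mem_source
          ((c.proj_param 0 0 ht rfl).trans c.map_center.symm)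
      exact p.2 (subset_closure
        ⟨_, he, c.above 0 j (Fin.pos_of_ne_zero h0) _ hm _ hj he⟩)
  · exact absurd (branch_mem_closure_lowerSet c) p.2

/-- The points of the semi-sheets are dense in the sheets. -/
theorem exists_semiPt_mem (p : F.SheetPt) {U : Set M} (hU : U ∈ 𝓝 p.1) :
    ∃ q : F.SemiPt, q.1 ∈ U := by
  obtain ⟨k, c, hp⟩ := exists_chart p
  -- The diagonal of the coordinate plane of the top sheet: for `t ≠ 0` it misses all the other
  -- coordinate planes.
  let l : ℝ → R3 := fun t i => if i = c.coord 0 then 0 else t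
  have hl : Continuous l := continuous_pi fun i => by
    simp only [l]; split_ifs <;> fun_prop
  have hl0 : l 0 = 0 := by ext; simp [l]
  have ht : ∀ x, x ∈ c.toHomeo.target := fun x => by rw [c.target_eq]; trivial
  have hc : ContinuousAt (fun t => c.param 0 (l t)) 0 := by
    have h1 : Continuous (fun t => c.param 0 (l t)) :=
      (c.smooth_param 0).continuousOn.comp_continuous hl fun t => ⟨ht _, by simp [l]⟩
    exact h1.continuousAt
  have hp0 : c.param 0 (l 0) = p.1 := by
    rw [hl0, ← c.map_center]
    exact c.param_proj 0 p.1 hp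
  have hev : ∀ᶠ t in 𝓝[≠] (0 : ℝ), c.param 0 (l t) ∈ U :=
    nhdsWithin_le_nhds (hc.eventually_mem (by rw [hp0]; exact hU))
  obtain ⟨t, h1, h2⟩ := (hev.and self_mem_nhdsWithin).exists
  have hl0 : l t (c.coord 0) = 0 := by simp [l]
  refine ⟨⟨c.param 0 (l t), notMem_closure_doubleSet c.toSheetChart
    (c.param_mem 0 _ (ht _) hl0) fun i hi => ?_⟩, h1⟩
  change c.toHomeo (F.emb _).1 _ ≠ 0
  rw [c.proj_param 0 _ (ht _) hl0]
  simpa [l, hi] using h2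

/-! ### Labels of semi-sheets that are labels of sheets -/

section Descent

variable {X : Type*} {f : F.SemiSheet → X}

/-- Two points on the same side of the double curve lie in one half-space, where the restricted
chart has a single sheet; for opposite sides the hypothesis applies. -/
theorem label_eq_of_two_sheets (hf : ∀ (c : SheetChart F.emb 2) (p q : F.SemiPt),
      p.1 ∈ c.sheet 0 → q.1 ∈ c.sheet 0 → c.side 1 (F.proj p.1) < 0 →
      0 < c.side 1 (F.proj q.1) → f (F.semiOf p) = f (F.semiOf q))
    (c : SheetChart F.emb 2) (p q : F.SemiPt) (hp : p.1 ∈ c.sheet 0) (hq : q.1 ∈ c.sheet 0) :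
    f (F.semiOf p) = f (F.semiOf q) := by
  have hp1 := side_ne_zero c (i := 1) p hp (by simp)
  have hq1 := side_ne_zero c (i := 1) q hq (by simp)
  have key : 0 < c.side 1 (F.proj p.1) * c.side 1 (F.proj q.1) →
      f (F.semiOf p) = f (F.semiOf q) := by
    intro h
    let c' := restrictChart c ![0] (strictMono_single 0)
      {x | 0 < c.side 1 (F.proj p.1) * x (c.coord 1)} (isOpen_halfSpace _ _)
      (convex_halfSpace _ _) (by
        intro i hi x hx h0
        have : i = 1 := by
          fin_cases i
          · simp at hi
          · rfl
        subst this
        simp [h0] at hx)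
    rw [semiOf_eq c' p q ⟨hp, mul_self_pos.mpr hp1⟩ ⟨hq, h⟩]
  rcases lt_or_gt_of_ne hp1 with h | h <;> rcases lt_or_gt_of_ne hq1 with h' | h'
  · exact key (mul_pos_of_neg_of_neg h h')
  · exact hf c p q hp hq h h'
  · exact (hf c q p hq hp h' h).symm
  · exact key (mul_pos h h')

/-- The lower sheets cut the top plane into quadrants. The passage from `p` to `q` goes through a
third point, so that each of the two moves concerns only one double curve. -/
theorem label_eq_of_three_sheets (hf : ∀ (c : SheetChart F.emb 2) (p q : F.SemiPt),
      p.1 ∈ c.sheet 0 → q.1 ∈ c.sheet 0 → c.side 1 (F.proj p.1) < 0 →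
      0 < c.side 1 (F.proj q.1) → f (F.semiOf p) = f (F.semiOf q))
    (c : SheetChart F.emb 3) (hc : c.toHomeo.target = Set.univ) (p q : F.SemiPt)
    (hp : p.1 ∈ c.sheet 0) (hq : q.1 ∈ c.sheet 0) :
    f (F.semiOf p) = f (F.semiOf q) := by
  set x := c.toHomeo (F.proj p.1) with hx
  set y := c.toHomeo (F.proj q.1) with hy
  -- This position is on the side of `p` with respect to sheet `2` and on the side of `q` with
  -- respect to sheet `1`.
  set z := Function.update y (c.coord 2) (x (c.coord 2)) with hz
  have hx2 : x (c.coord 2) ≠ 0 := side_ne_zero c (i := 2) p hp (by simp)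
  have hy1 : y (c.coord 1) ≠ 0 := side_ne_zero c (i := 1) q hq (by simp)
  have hz0 : z (c.coord 0) = 0 := by
    rw [hz, Function.update_of_ne (c.coord.injective.ne (by simp))]
    exact c.mem_plane 0 q.1 hq
  have hz1 : z (c.coord 1) = y (c.coord 1) := by
    rw [hz, Function.update_of_ne (c.coord.injective.ne (by simp))]
  have hz2 : z (c.coord 2) = x (c.coord 2) := by simp [hz]
  have ht : z ∈ c.toHomeo.target := by rw [hc]; trivial
  have hr := c.param_mem 0 z ht hz0
  have hrz : c.toHomeo (F.proj (c.param 0 z)) = z := c.proj_param 0 z ht hz0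
  let r : F.SemiPt := ⟨c.param 0 z, notMem_closure_doubleSet c hr fun i hi => by
    rw [SheetChart.side, hrz]
    fin_cases i
    · exact absurd rfl hi
    · exact hz1.trans_ne hy1
    · exact hz2.trans_ne hx2⟩
  let c₁ := restrictChart c ![0, 1] (strictMono_pair (by simp))
    {w | 0 < x (c.coord 2) * w (c.coord 2)} (isOpen_halfSpace _ _) (convex_halfSpace _ _) (by
      intro i hi w hw h0
      have : i = 2 := by
        fin_cases i
        · simp at hi
        · simp at hi
        · rfl
      subst this
      simp [h0] at hw)
  let c₂ := restrictChart c ![0, 2] (strictMono_pair (by simp))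
    {w | 0 < y (c.coord 1) * w (c.coord 1)} (isOpen_halfSpace _ _) (convex_halfSpace _ _) (by
      intro i hi w hw h0
      have : i = 1 := by
        fin_cases i
        · simp at hi
        · rfl
        · simp at hi
      subst this
      simp [h0] at hw)
  have e₁ : f (F.semiOf p) = f (F.semiOf r) :=
    label_eq_of_two_sheets hf c₁ p r ⟨hp, mul_self_pos.mpr hx2⟩ ⟨hr, by
      change 0 < _ * c.toHomeo (F.proj (c.param 0 z)) _
      rw [hrz, hz2]
      exact mul_self_pos.mpr hx2⟩
  have e₂ : f (F.semiOf r) = f (F.semiOf q) :=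
    label_eq_of_two_sheets hf c₂ r q ⟨hr, by
      change 0 < _ * c.toHomeo (F.proj (c.param 0 z)) _
      rw [hrz, hz1]
      exact mul_self_pos.mpr hy1⟩ ⟨hq, mul_self_pos.mpr hy1⟩
  exact e₁.trans e₂

/-- Labels of semi-sheets that do not change across a double curve of the over-sheet are labels of
sheets. -/
theorem label_eq_of_sheetOf_eq (hf : ∀ (c : SheetChart F.emb 2) (p q : F.SemiPt),
      p.1 ∈ c.sheet 0 → q.1 ∈ c.sheet 0 → c.side 1 (F.proj p.1) < 0 →
      0 < c.side 1 (F.proj q.1) → f (F.semiOf p) = f (F.semiOf q))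
    (p q : F.SemiPt) (h : F.sheetOf p.toSheetPt = F.sheetOf q.toSheetPt) :
    f (F.semiOf p) = f (F.semiOf q) := by
  have hloc : ∀ p : F.SheetPt, ∃ N : Set M, IsOpen N ∧ p.1 ∈ N ∧ ∀ q r : F.SemiPt,
      q.1 ∈ N → r.1 ∈ N → f (F.semiOf q) = f (F.semiOf r) := by
    intro p
    obtain ⟨k, c, hp⟩ := exists_chart p
    refine ⟨c.sheet 0, c.isOpen_sheet 0, hp, fun q r hq hr => ?_⟩
    -- Distinct sheets of a chart use distinct coordinates of `ℝ³`.
    have hk : k + 1 ≤ 3 := by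
      simpa using Fintype.card_le_of_injective _ c.coord.injective
    obtain rfl | rfl | rfl : k = 0 ∨ k = 1 ∨ k = 2 := by omega
    · rw [semiOf_eq c.toSheetChart q r hq hr]
    · exact label_eq_of_two_sheets hf c.toSheetChart q r hq hr
    · exact label_eq_of_three_sheets hf c.toSheetChart c.target_eq q r hq hr
  choose N hN hpN hlab using hloc
  -- The labels are extended to all points of sheets by the value at a nearby point of a semi-sheet.
  -- The extension is locally constant, hence constant on each sheet.
  choose s hs using fun p : F.SheetPt => exists_semiPt_mem p ((hN p).mem_nhds (hpN p))
  have hG : IsLocallyConstant fun p => f (F.semiOf (s p)) := by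
    rw [IsLocallyConstant.iff_exists_open]
    intro p
    refine ⟨Subtype.val ⁻¹' N p, (hN p).preimage continuous_subtype_val, hpN p, fun p' hp' => ?_⟩
    obtain ⟨t, ht, ht'⟩ := exists_semiPt_mem p'
      (((hN p).inter (hN p')).mem_nhds ⟨hp', hpN p'⟩)
    exact (hlab p' _ _ (hs p') ht').trans (hlab p _ _ ht (hs p))
  have hGp : ∀ p : F.SemiPt, f (F.semiOf (s p.toSheetPt)) = f (F.semiOf p) := fun p =>
    hlab p.toSheetPt _ _ (hs _) (hpN p.toSheetPt)
  rw [← hGp p, ← hGp q]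
  exact hG.apply_eq_of_isPreconnected isPreconnected_connectedComponent mem_connectedComponent
    (ConnectedComponents.coe_eq_coe'.mp h.symm)

end Descent

end SurfaceDiagram

end SymDouble

namespace SymDouble

/-! ### The symmetric double -/

section Double

variable {X : Type*} [Quandle X]

theorem rho_elt (x : Double X) : (SymmetricQuandle.rho x).elt = x.elt := rfl

theorem act_elt_of_pos {x : Double X} (h : x.pos = true) (y : Double X) :
    (x ◃ y).elt = x.elt ◃ y.elt := by
  change opSign _ _ _ = _
  simp [opSign, h]

theorem act_elt_of_neg {x : Double X} (h : x.pos = false) (y : Double X) :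
    (x ◃ y).elt = x.elt ◃⁻¹ y.elt := by
  change opSign _ _ _ = _
  simp [opSign, h]

variable {Y : Type*} [MulAction (AssocGroup X)ᵐᵒᵖ Y]

theorem symSetAct_double (r : Y) (x : Double X) :
    symSetAct r x = MulOpposite.op (AssocGroup.ofDouble x) • r := by
  change MulOpposite.op (doubleProj X (SymAssocGroup.of x)) • r = _
  congr 2
  exact PresentedGroup.toGroup.of _

theorem symSetAct_of_pos {x : Double X} (h : x.pos = true) (r : Y) :
    symSetAct r x = setAct r x.elt := by
  rw [symSetAct_double, AssocGroup.ofDouble, if_pos h, setAct]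

/-- A negative generator acts by the inverse; the cancellation form avoids naming an inverse action
on `Y`. -/
theorem setAct_symSetAct_of_neg {x : Double X} (h : x.pos = false) (r : Y) :
    setAct (symSetAct r x) x.elt = r := by
  rw [symSetAct_double, AssocGroup.ofDouble, if_neg (by simp [h]), setAct, smul_smul,
    ← MulOpposite.op_mul]
  simp

end Double

namespace SurfaceDiagram

variable {M : Type*} [TopologicalSpace M] [ChartedSpace (EuclideanSpace ℝ (Fin 2)) M]
  [IsManifold (𝓡 2) ∞ M] {F : SurfaceDiagram M}
  {X Y : Type*} [Quandle X] [MulAction (AssocGroup X)ᵐᵒᵖ Y] {o : SurfaceOrientation M}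

set_option linter.unusedSectionVars false

/-! ### Functions on the set of semi-sheets -/

/-- A surface is locally connected and the semi-sheet points form an open subset, so components are
open and the space of semi-sheets is discrete. -/
theorem continuous_semiOf_comp {α : Type*} [TopologicalSpace α] (f : F.SemiSheet → α) :
    Continuous fun p => f (F.semiOf p) := by
  have : LocallyConnectedSpace M :=
    ChartedSpace.locallyConnectedSpace (EuclideanSpace ℝ (Fin 2)) M
  have : LocallyConnectedSpace F.SemiPt := isClosed_closure.isOpen_compl.locallyConnectedSpace
  have : DiscreteTopology F.SemiSheet :=
    ConnectedComponents.discreteTopology_iff.mpr fun _ => isOpen_connectedComponent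
  exact continuous_of_discreteTopology.comp ConnectedComponents.continuous_coe

/-! ### Properties of the canonical form -/

section CanonicalForm

variable (a : F.SymAssignment (Double X) Y)

theorem continuous_canonicalNormal : Continuous a.canonicalNormal := by
  have h : a.canonicalNormal = fun p =>
      (if (a.label (F.semiOf p)).pos then (1 : ℝ) else -1) • a.normal p := by
    funext p
    simp only [SymAssignment.canonicalNormal]
    split_ifs <;> simp
  rw [h]
  exact (continuous_semiOf_comp fun s => if (a.label s).pos then (1 : ℝ) else -1).smul
    a.continuous_normal

/-- The involution changes only the sign of an element of the double, so the coherent and incoherent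
cases agree once signs are forgotten. -/
theorem elt_label_eq_of_over (c : SheetChart F.emb 2) (p q : F.SemiPt)
    (hp : p.1 ∈ c.sheet 0) (hq : q.1 ∈ c.sheet 0)
    (h1 : c.side 1 (F.proj p.1) < 0) (h2 : 0 < c.side 1 (F.proj q.1)) :
    (a.label (F.semiOf p)).elt = (a.label (F.semiOf q)).elt := by
  obtain ⟨h, h'⟩ := a.over_cond c p q hp hq h1 h2
  rcases lt_or_gt_of_ne (mul_ne_zero (dside_ne_zero c hp (a.isUnitNormal p))
    (dside_ne_zero c hq (a.isUnitNormal q))) with hs | hs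
  · rw [h' hs, rho_elt]
  · rw [h hs]

theorem act_elt_label_eq (c : SheetChart F.emb 2) (p q d : F.SemiPt)
    (hp : p.1 ∈ c.sheet 1) (hq : q.1 ∈ c.sheet 1) (hd : d.1 ∈ c.sheet 0)
    (h1 : c.dside 0 (F.proj d.1) (a.normal d) * c.side 0 (F.proj p.1) < 0)
    (h2 : 0 < c.dside 0 (F.proj d.1) (a.normal d) * c.side 0 (F.proj q.1)) :
    (a.label (F.semiOf d) ◃ a.label (F.semiOf p)).elt = (a.label (F.semiOf q)).elt := by
  obtain ⟨h, h'⟩ := a.under_cond c p q d hp hq hd h1 h2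
  rcases lt_or_gt_of_ne (mul_ne_zero (dside_ne_zero c hp (a.isUnitNormal p))
    (dside_ne_zero c hq (a.isUnitNormal q))) with hs | hs
  · rw [h' hs, rho_elt]
  · rw [h hs]

/-- If the over-label is negative, the canonical normal is the opposite one. The two under-sheets
then exchange roles, which compensates for the inverse action. -/
theorem elt_act_elt_eq_of_under (c : SheetChart F.emb 2) (p q d : F.SemiPt)
    (hp : p.1 ∈ c.sheet 1) (hq : q.1 ∈ c.sheet 1) (hd : d.1 ∈ c.sheet 0)
    (h1 : c.dside 0 (F.proj d.1) (a.canonicalNormal d) * c.side 0 (F.proj p.1) < 0)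
    (h2 : 0 < c.dside 0 (F.proj d.1) (a.canonicalNormal d) * c.side 0 (F.proj q.1)) :
    (a.label (F.semiOf d)).elt ◃ (a.label (F.semiOf p)).elt = (a.label (F.semiOf q)).elt := by
  cases hpos : (a.label (F.semiOf d)).pos
  · have hn : a.canonicalNormal d = -a.normal d := by
      simp [SymAssignment.canonicalNormal, hpos]
    rw [hn, dside_neg, neg_mul] at h1 h2
    have h := act_elt_label_eq a c q p d hq hp hd (by linarith) (by linarith)
    rw [act_elt_of_neg hpos] at h
    rw [← h, Rack.act_invAct_eq]
  · have hn : a.canonicalNormal d = a.normal d := by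
      simp [SymAssignment.canonicalNormal, hpos]
    rw [hn] at h1 h2
    rw [← act_elt_of_pos hpos]
    exact act_elt_label_eq a c p q d hp hq hd h1 h2

theorem setAct_region_elt_label (c : SheetChart F.emb 1) (p : F.SemiPt) (y₁ y₂ : F.RegionPt)
    (hp : p.1 ∈ c.sheet 0) (hy₁ : y₁.1 ∈ c.toHomeo.source) (hy₂ : y₂.1 ∈ c.toHomeo.source)
    (h1 : c.dside 0 (F.proj p.1) (a.canonicalNormal p) * c.side 0 y₁.1 < 0)
    (h2 : 0 < c.dside 0 (F.proj p.1) (a.canonicalNormal p) * c.side 0 y₂.1) :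
    setAct (a.region (F.regionOf y₁)) (a.label (F.semiOf p)).elt = a.region (F.regionOf y₂) := by
  cases hpos : (a.label (F.semiOf p)).pos
  · have hn : a.canonicalNormal p = -a.normal p := by
      simp [SymAssignment.canonicalNormal, hpos]
    rw [hn, dside_neg, neg_mul] at h1 h2
    rw [← a.region_cond c p y₂ y₁ hp hy₂ hy₁ (by linarith) (by linarith),
      setAct_symSetAct_of_neg hpos]
  · have hn : a.canonicalNormal p = a.normal p := by
      simp [SymAssignment.canonicalNormal, hpos]
    rw [hn] at h1 h2
    rw [← a.region_cond c p y₁ y₂ hp hy₁ hy₂ h1 h2, symSetAct_of_pos hpos]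

end CanonicalForm

/-! ### From colorings by the quandle to colorings by its double -/

theorem continuous_toSheetPt : Continuous (SemiPt.toSheetPt (F := F)) :=
  Continuous.subtype_mk continuous_subtype_val _

/-- The sheet that contains a given semi-sheet. -/
def sheetOfSemi : F.SemiSheet → F.Sheet := continuous_toSheetPt.connectedComponentsMap

theorem sheetOfSemi_semiOf (p : F.SemiPt) :
    sheetOfSemi (F.semiOf p) = F.sheetOf p.toSheetPt := rfl

/-- Semi-sheet points are dense, so every sheet contains some. A label of a sheet is thus determined
by its restriction to semi-sheets. -/
theorem exists_semiPt_sheetOf_eq (s : F.Sheet) :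
    ∃ p : F.SemiPt, F.sheetOf p.toSheetPt = s := by
  obtain ⟨q, rfl⟩ := ConnectedComponents.surjective_coe s
  obtain ⟨k, c, hq⟩ := exists_chart q
  obtain ⟨p, hp⟩ := exists_semiPt_mem q ((c.isOpen_sheet 0).mem_nhds hq)
  exact ⟨p, sheetOf_eq c.toSheetChart _ _ hp hq⟩

/-- The coloring by the double with positive labels that corresponds to an `X_Y`-coloring of an
oriented diagram. -/
def QColoring.toSymAssignment (C : F.QColoring o X Y) (n : F.SemiPt → R3) (hn : Continuous n)
    (hno : ∀ p : F.SemiPt, F.IsNormal o p.1 (n p)) : F.SymAssignment (Double X) Y where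
  normal := n
  continuous_normal := hn
  isUnitNormal p := (hno p).1
  label s := ⟨C.label (sheetOfSemi s), true⟩
  region := C.region
  over_cond c a b ha hb _ _ := by
    refine ⟨fun _ => ?_, fun h => ?_⟩
    · simp only [sheetOfSemi_semiOf]
      rw [sheetOf_eq c _ _ (show a.toSheetPt.1 ∈ _ from ha) (show b.toSheetPt.1 ∈ _ from hb)]
    -- Normals representing `o` are coherent, so this case is empty.
    · exact absurd h (dside_mul_dside_pos c ha hb (hno a) (hno b)).not_gt
  under_cond c a b d ha hb hd h1 h2 := by
    refine ⟨fun _ => ?_, fun h => ?_⟩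
    · simp only [sheetOfSemi_semiOf]
      rw [← C.double_cond c a.toSheetPt b.toSheetPt d.toSheetPt (n d) ha hb hd (hno d) h1 h2]
      exact Double.ext (act_elt_of_pos rfl _) rfl
    · exact absurd h (dside_mul_dside_pos c ha hb (hno a) (hno b)).not_gt
  region_cond c p y₁ y₂ hp hy₁ hy₂ h1 h2 := by
    rw [symSetAct_of_pos rfl, sheetOfSemi_semiOf]
    exact C.region_cond c p.toSheetPt y₁ y₂ (n p) hp hy₁ hy₂ (hno p) h1 h2

/-! ### From colorings by the double to colorings by the quandle -/

/-- A coloring by the double whose canonical form induces the given orientation comes from an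
`X_Y`-coloring. -/
theorem exists_qColoring (a : F.SymAssignment (Double X) Y)
    (ha : ∀ p : F.SemiPt, F.IsNormal o p.1 (a.canonicalNormal p)) :
    ∃ C : F.QColoring o X Y, C.region = a.region ∧ ∀ p : F.SemiPt,
      C.label (F.sheetOf p.toSheetPt) = (a.label (F.semiOf p)).elt := by
  choose s hs using exists_semiPt_sheetOf_eq (F := F)
  let lab : F.Sheet → X := fun t => (a.label (F.semiOf (s t))).elt
  have hlab : ∀ p : F.SemiPt, lab (F.sheetOf p.toSheetPt) = (a.label (F.semiOf p)).elt := fun p =>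
    label_eq_of_sheetOf_eq (f := fun t => (a.label t).elt) (elt_label_eq_of_over a) _ p (hs _)
  have hsemi : ∀ (p : F.SheetPt) (h : p.1 ∉ closure F.doubleSet),
      lab (F.sheetOf p) = (a.label (F.semiOf ⟨p.1, h⟩)).elt := fun p h => hlab ⟨p.1, h⟩
  refine ⟨⟨lab, a.region, ?_, ?_⟩, rfl, hlab⟩
  · intro c p q d v hp hq hd hv h1 h2
    -- The strict side conditions keep the two under-points off the double curve.
    have hside : ∀ r : F.SheetPt, r.1 ∈ c.sheet 1 → c.side 0 (F.proj r.1) ≠ 0 →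
        r.1 ∉ closure F.doubleSet := fun r hr h => by
      refine notMem_closure_doubleSet c hr fun i hi => ?_
      obtain rfl : i = 0 := by
        fin_cases i
        · rfl
        · exact absurd rfl hi
      exact h
    have hp' := hside p hp (right_ne_zero_of_mul h1.ne)
    have hq' := hside q hq (right_ne_zero_of_mul h2.ne')
    -- The over-point `d` may lie on the double curve itself. A nearby point of the same chart sheet
    -- replaces it, and coherence transfers the side conditions.
    obtain ⟨d', hd'⟩ := exists_semiPt_mem d ((c.isOpen_sheet 0).mem_nhds hd)
    rw [hsemi p hp', hsemi q hq', sheetOf_eq c d d'.toSheetPt hd hd', hlab]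
    have hpos := dside_mul_dside_pos c hd' hd (ha d') hv
    refine elt_act_elt_eq_of_under a c ⟨p.1, hp'⟩ ⟨q.1, hq'⟩ d' hp hq hd' ?_ ?_
    · have := mul_pos_trans hpos (c := -c.side 0 (F.proj p.1)) (by linarith)
      linarith
    · exact mul_pos_trans hpos h2
  · intro c p y₁ y₂ v hp hy₁ hy₂ hv h1 h2
    have hp' : p.1 ∉ closure F.doubleSet :=
      notMem_closure_doubleSet c hp fun i hi => absurd (Subsingleton.elim i 0) hi
    rw [hsemi p hp']
    have hpos := dside_mul_dside_pos c hp hp (ha ⟨p.1, hp'⟩) hv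
    refine setAct_region_elt_label a c ⟨p.1, hp'⟩ y₁ y₂ hp hy₁ hy₂ ?_ ?_
    · have := mul_pos_trans hpos (c := -c.side 0 y₁.1) (by linarith)
      linarith
    · exact mul_pos_trans hpos h2

/-! ### The bijection of the sets of colorings -/

theorem OriClass.continuous_canonicalNormal (c : F.OriClass X Y) :
    Continuous c.canonicalNormal := by
  obtain ⟨C, rfl⟩ := Quotient.exists_rep c
  obtain ⟨a, rfl⟩ := Quotient.exists_rep C
  exact SurfaceDiagram.continuous_canonicalNormal a

/-- The coloring by the double in a given orientation class that corresponds to an `X_Y`-coloring of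
the diagram with the induced orientation. -/
def QColoring.toOriClass (c : F.OriClass X Y) (hc : c.Induces o) (C : F.QColoring o X Y) :
    {C : F.SymColoring (Double X) Y // C.oriClass = c} :=
  ⟨Quotient.mk _ (C.toSymAssignment c.canonicalNormal c.continuous_canonicalNormal hc), by
    -- All labels are positive, so the canonical normals are by definition the given ones.
    obtain ⟨C', rfl⟩ := Quotient.exists_rep c
    exact Quotient.sound rfl⟩

/-- An inversion preserves the underlying element of `X`, so the labels can be recovered from the
class. Conversely, an assignment differs from its canonical form by inversions exactly where its
labels are negative. -/
theorem QColoring.toOriClass_bijective (c : F.OriClass X Y) (hc : c.Induces o) :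
    Function.Bijective (QColoring.toOriClass c hc) := by
  constructor
  · intro C C' h
    obtain ⟨h1, h2⟩ := Quotient.exact (congrArg Subtype.val h)
    refine QColoring.ext (funext fun s => ?_) h1
    obtain ⟨p, rfl⟩ := exists_semiPt_sheetOf_eq s
    rcases h2 p with ⟨-, h3⟩ | ⟨-, h3⟩
    · exact (congrArg Double.elt h3).symm
    · exact (congrArg Double.elt h3).symm
  · rintro ⟨C, rfl⟩
    obtain ⟨a, rfl⟩ := Quotient.exists_rep C
    obtain ⟨C, hr, hl⟩ := exists_qColoring a hc
    refine ⟨C, Subtype.ext (Quotient.sound ⟨hr, fun p => ?_⟩)⟩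
    change (a.normal p = a.canonicalNormal p ∧
        a.label (F.semiOf p) = ⟨C.label (F.sheetOf p.toSheetPt), true⟩) ∨
      (a.normal p = -a.canonicalNormal p ∧
        a.label (F.semiOf p) = ⟨C.label (F.sheetOf p.toSheetPt), false⟩)
    rw [hl p]
    cases hpos : (a.label (F.semiOf p)).pos
    · exact Or.inr ⟨by simp [SymAssignment.canonicalNormal, hpos], Double.ext rfl hpos⟩
    · exact Or.inl ⟨by simp [SymAssignment.canonicalNormal, hpos], Double.ext rfl hpos⟩

end SurfaceDiagram

end SymDouble

namespace SymDouble

theorem mul_neg_trans {a b c : ℝ} (h₁ : b * a < 0) (h₂ : 0 < b * c) : a * c < 0 := by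
  have := mul_pos_trans (a := -a) (by linarith) h₂
  linarith

namespace SurfaceDiagram

variable {M : Type*} [TopologicalSpace M] [ChartedSpace (EuclideanSpace ℝ (Fin 2)) M]
  [IsManifold (𝓡 2) ∞ M] {F : SurfaceDiagram M}

set_option linter.unusedSectionVars false

/-! ### Labels with a prescribed side of the normal orientation -/

section LabelAt

variable {X Y : Type*} [SymmetricQuandle X] [MulAction (SymAssocGroup X)ᵐᵒᵖ Y]
  (a : F.SymAssignment X Y)

/-- The label of a semi-sheet, after a basic inversion if necessary to make its normal orientation
point away from the side of the sheet given by the sign of `s`. -/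
def labelAt {k : ℕ} (c : SheetChart F.emb k) (j : Fin k) (s : ℝ) (p : F.SemiPt) : X :=
  if s * c.dside j (F.proj p.1) (a.normal p) < 0 then a.label (F.semiOf p)
  else SymmetricQuandle.rho (a.label (F.semiOf p))

theorem labelAt_neg {k : ℕ} (c : SheetChart F.emb k) {j : Fin k} {s : ℝ} (hs : s ≠ 0)
    {p : F.SemiPt} (hp : p.1 ∈ c.sheet j) :
    labelAt a c j (-s) p = SymmetricQuandle.rho (labelAt a c j s p) := by
  have hne := mul_ne_zero hs (dside_ne_zero c hp (a.isUnitNormal p))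
  simp only [labelAt, neg_mul]
  rcases lt_or_gt_of_ne hne with h | h
  · rw [if_neg (by linarith), if_pos h]
  · rw [if_pos (by linarith), if_neg h.not_gt, SymmetricQuandle.rho_rho]

/-- Once the side of the normal is prescribed, both cases of `over_cond` become one equality. -/
theorem labelAt_eq_of_over (c : SheetChart F.emb 2) {s : ℝ} (hs : s ≠ 0) {p q : F.SemiPt}
    (hp : p.1 ∈ c.sheet 0) (hq : q.1 ∈ c.sheet 0)
    (h : c.side 1 (F.proj p.1) * c.side 1 (F.proj q.1) < 0) :
    labelAt a c 0 s p = labelAt a c 0 s q := by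
  wlog h1 : c.side 1 (F.proj p.1) < 0 generalizing p q
  · rcases mul_neg_iff.mp h with ⟨_, h2⟩ | ⟨h2, _⟩
    · exact (this hq hp (by rwa [mul_comm]) h2).symm
    · exact absurd h2 h1
  have h2 : 0 < c.side 1 (F.proj q.1) := pos_of_mul_neg_right h h1.le
  obtain ⟨e, e'⟩ := a.over_cond c p q hp hq h1 h2
  have hnp := mul_ne_zero hs (dside_ne_zero c hp (a.isUnitNormal p))
  have hnq := mul_ne_zero hs (dside_ne_zero c hq (a.isUnitNormal q))
  simp only [labelAt]
  rcases lt_or_gt_of_ne hnp with h3 | h3 <;> rcases lt_or_gt_of_ne hnq with h4 | h4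
  · rw [if_pos h3, if_pos h4]
    have := mul_neg_trans h3 (c := -c.dside 0 (F.proj q.1) (a.normal q)) (by linarith)
    exact e (by linarith)
  · rw [if_pos h3, if_neg h4.not_gt]
    exact e' (mul_neg_trans h3 h4)
  · rw [if_neg h3.not_gt, if_pos h4,
      e' (by rw [mul_comm]; exact mul_neg_trans h4 h3), SymmetricQuandle.rho_rho]
  · rw [if_neg h3.not_gt, if_neg h4.not_gt, e (mul_pos_trans (by rwa [mul_comm]) h4)]

/-- Goodness of the involution, `rho_act`, lets the inversions of the under-sheet pass through the
action. -/
theorem label_act_labelAt (c : SheetChart F.emb 2) {s : ℝ} (hs : s ≠ 0) {p q d : F.SemiPt}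
    (hp : p.1 ∈ c.sheet 1) (hq : q.1 ∈ c.sheet 1) (hd : d.1 ∈ c.sheet 0)
    (h1 : c.dside 0 (F.proj d.1) (a.normal d) * c.side 0 (F.proj p.1) < 0)
    (h2 : 0 < c.dside 0 (F.proj d.1) (a.normal d) * c.side 0 (F.proj q.1)) :
    a.label (F.semiOf d) ◃ labelAt a c 1 s p = labelAt a c 1 s q := by
  obtain ⟨e, e'⟩ := a.under_cond c p q d hp hq hd h1 h2
  have hnp := mul_ne_zero hs (dside_ne_zero c hp (a.isUnitNormal p))
  have hnq := mul_ne_zero hs (dside_ne_zero c hq (a.isUnitNormal q))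
  simp only [labelAt]
  rcases lt_or_gt_of_ne hnp with h3 | h3 <;> rcases lt_or_gt_of_ne hnq with h4 | h4
  · rw [if_pos h3, if_pos h4]
    have := mul_neg_trans h3 (c := -c.dside 1 (F.proj q.1) (a.normal q)) (by linarith)
    exact e (by linarith)
  · rw [if_pos h3, if_neg h4.not_gt]
    exact e' (mul_neg_trans h3 h4)
  · rw [if_neg h3.not_gt, if_pos h4, ← SymmetricQuandle.rho_act,
      e' (by rw [mul_comm]; exact mul_neg_trans h4 h3), SymmetricQuandle.rho_rho]
  · rw [if_neg h3.not_gt, if_neg h4.not_gt, ← SymmetricQuandle.rho_act,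
      e (mul_pos_trans (by rwa [mul_comm]) h4)]

/-- If the over-normal has to be reversed, `p` and `q` exchange roles and `act_rho` turns the action
into its inverse. -/
theorem labelAt_act_labelAt (c : SheetChart F.emb 2) {s t : ℝ} (hs : s ≠ 0) {p q d : F.SemiPt}
    (hp : p.1 ∈ c.sheet 1) (hq : q.1 ∈ c.sheet 1) (hd : d.1 ∈ c.sheet 0)
    (h1 : 0 < t * c.side 0 (F.proj p.1)) (h2 : t * c.side 0 (F.proj q.1) < 0) :
    labelAt a c 0 t d ◃ labelAt a c 1 s p = labelAt a c 1 s q := by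
  have hnd := mul_ne_zero (left_ne_zero_of_mul h1.ne') (dside_ne_zero c hd (a.isUnitNormal d))
  rcases lt_or_gt_of_ne hnd with h | h
  · have h3 : labelAt a c 0 t d = a.label (F.semiOf d) := if_pos h
    rw [h3]
    have h4 := mul_neg_trans h (c := -c.side 0 (F.proj q.1)) (by linarith)
    exact label_act_labelAt a c hs hp hq hd (mul_neg_trans h h1) (by linarith)
  · have h3 : labelAt a c 0 t d = SymmetricQuandle.rho (a.label (F.semiOf d)) := if_neg h.not_gt
    rw [h3, SymmetricQuandle.act_rho, ← label_act_labelAt a c hs hq hp hd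
      (by rw [mul_comm]; exact mul_neg_trans h2 h)
      (mul_pos_trans (by rwa [mul_comm]) h1), Rack.invAct_act_eq]

theorem symSetAct_region_labelAt (c : SheetChart F.emb 1) {t : ℝ} {p : F.SemiPt}
    {y₁ y₂ : F.RegionPt} (hp : p.1 ∈ c.sheet 0) (hy₁ : y₁.1 ∈ c.toHomeo.source)
    (hy₂ : y₂.1 ∈ c.toHomeo.source) (h1 : 0 < t * c.side 0 y₁.1) (h2 : t * c.side 0 y₂.1 < 0) :
    symSetAct (a.region (F.regionOf y₁)) (labelAt a c 0 t p) = a.region (F.regionOf y₂) := by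
  have hnd := mul_ne_zero (left_ne_zero_of_mul h1.ne') (dside_ne_zero c hp (a.isUnitNormal p))
  rcases lt_or_gt_of_ne hnd with h | h
  · have h3 : labelAt a c 0 t p = a.label (F.semiOf p) := if_pos h
    rw [h3]
    have h4 := mul_neg_trans h (c := -c.side 0 y₂.1) (by linarith)
    exact a.region_cond c p y₁ y₂ hp hy₁ hy₂ (mul_neg_trans h h1) (by linarith)
  · have h3 : labelAt a c 0 t p = SymmetricQuandle.rho (a.label (F.semiOf p)) := if_neg h.not_gt
    rw [h3, ← a.region_cond c p y₂ y₁ hp hy₂ hy₁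
      (by rw [mul_comm]; exact mul_neg_trans h2 h)
      (mul_pos_trans (by rwa [mul_comm]) h1), symSetAct_rho]

end LabelAt

/-! ### Octants around a triple point -/

section Octant

variable (τ : F.TriplePt) (ε : Octant)

theorem Octant.point_mul_self (ε : Octant) (j : Fin 3) : ε.point j * ε.point j = 1 := by
  rcases Int.units_eq_one_or (ε j) with h | h <;> simp [Octant.point, h]

/-- The octant on the other side of the `j`-th coordinate plane. -/
def Octant.flip (ε : Octant) (j : Fin 3) : Octant := Function.update ε j (-ε j)

theorem Octant.flip_point_self (ε : Octant) (j : Fin 3) : (ε.flip j).point j = -ε.point j := by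
  simp [Octant.flip, Octant.point]

theorem Octant.flip_of_ne (ε : Octant) {i j : Fin 3} (h : i ≠ j) : ε.flip j i = ε i := by
  simp [Octant.flip, h]

theorem Octant.flip_point_of_ne (ε : Octant) {i j : Fin 3} (h : i ≠ j) :
    (ε.flip j).point i = ε.point i := by
  simp [Octant.point, ε.flip_of_ne h]

theorem mem_target (x : R3) : x ∈ τ.chart.toHomeo.target := by
  rw [τ.chart.target_eq]; trivial

/-- The restriction of the chart around a triple point to the set of the points that lie on the
same sides of the omitted sheets as the given octant. -/
def octantChart {m : ℕ} (σ : Fin m → Fin 3) (hσ : StrictMono σ) : SheetChart F.emb m :=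
  restrictChart τ.chart.toSheetChart σ hσ
    (⋂ k ∈ (Set.range σ)ᶜ, {x : R3 | 0 < ε.point k * x k})
    (Set.toFinite _ |>.isOpen_biInter fun k _ => isOpen_halfSpace _ _)
    (convex_iInter₂ fun k _ => convex_halfSpace _ _) (by
      intro i hi x hx h0
      have := Set.mem_iInter₂.mp hx i hi
      rw [τ.coord_eq] at h0
      simp [h0] at this)

theorem toHomeo_facePt (j : Fin 3) :
    τ.chart.toHomeo (F.proj (τ.facePt ε j).1) = Function.update ε.point j 0 :=
  τ.chart.proj_param j _ (mem_target τ _) (by rw [τ.coord_eq]; simp)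

theorem side_facePt {i j : Fin 3} (h : i ≠ j) :
    τ.chart.side i (F.proj (τ.facePt ε j).1) = ε.point i := by
  rw [SheetChart.side, toHomeo_facePt, τ.coord_eq, Function.update_of_ne h]

theorem toHomeo_regionPt : τ.chart.toHomeo (τ.regionPt ε).1 = ε.point :=
  τ.chart.toHomeo.right_inv (mem_target τ _)

theorem side_regionPt (i : Fin 3) : τ.chart.side i (τ.regionPt ε).1 = ε.point i := by
  rw [SheetChart.side, toHomeo_regionPt, τ.coord_eq]

variable {ε}

/-- Octants that agree off the range of `σ` lie on the same sides of the omitted sheets, so their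
faces are seen in one restricted chart and the coloring conditions apply there. -/
theorem facePt_mem_octantChart {m : ℕ} {σ : Fin m → Fin 3} (hσ : StrictMono σ) {ε' : Octant}
    (h : ∀ k ∉ Set.range σ, ε' k = ε k) (i : Fin m) :
    (τ.facePt ε' (σ i)).1 ∈ (octantChart τ ε σ hσ).sheet i := by
  refine ⟨τ.facePt_mem ε' _, Set.mem_iInter₂.mpr fun k hk => ?_⟩
  change 0 < ε.point k * τ.chart.toHomeo (F.proj (τ.facePt ε' (σ i)).1) k
  rw [toHomeo_facePt, Function.update_of_ne (fun h => hk ⟨i, h.symm⟩), Octant.point, Octant.point,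
    h k hk]
  exact mul_self_pos.mpr (ε.point_ne_zero k)

theorem regionPt_mem_octantChart {m : ℕ} {σ : Fin m → Fin 3} (hσ : StrictMono σ) {ε' : Octant}
    (h : ∀ k ∉ Set.range σ, ε' k = ε k) :
    (τ.regionPt ε').1 ∈ (octantChart τ ε σ hσ).toHomeo.source := by
  have h1 : (τ.regionPt ε').1 ∈ τ.chart.toHomeo.source :=
    τ.chart.toHomeo.map_target (mem_target τ _)
  change _ ∈ (τ.chart.toHomeo.trans (OpenPartialHomeomorph.ofSet _ _)).source
  rw [OpenPartialHomeomorph.trans_source]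
  refine ⟨h1, Set.mem_iInter₂.mpr fun k hk => ?_⟩
  change 0 < ε.point k * τ.chart.toHomeo (τ.regionPt ε').1 k
  rw [toHomeo_regionPt, Octant.point, Octant.point, h k hk]
  exact mul_self_pos.mpr (ε.point_ne_zero k)

/-- The face point has its `j`-th coordinate set to zero, so it forgets the side. -/
theorem facePt_flip_self (j : Fin 3) : τ.facePt (ε.flip j) j = τ.facePt ε j := by
  apply Subtype.ext
  change τ.chart.param j _ = τ.chart.param j _
  congr 1
  funext i
  rcases eq_or_ne i j with rfl | h
  · simp
  · simp [Function.update_of_ne h, ε.flip_point_of_ne h]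

end Octant

/-! ### The sign of a triple point -/

section Sign

variable (τ : F.TriplePt)

theorem param_zero_mem (j : Fin 3) : τ.chart.param j 0 ∈ τ.chart.sheet j :=
  τ.chart.param_mem j 0 (mem_target τ 0) rfl

theorem proj_param_zero (j : Fin 3) : F.proj (τ.chart.param j 0) = τ.1 :=
  τ.chart.toHomeo.injOn (proj_mem_source τ.chart.toSheetChart (param_zero_mem τ j))
    τ.chart.mem_source
    ((τ.chart.proj_param j 0 (mem_target τ 0) rfl).trans τ.chart.map_center.symm)

theorem fderiv_toHomeo_injective {k : ℕ} (c : SheetChart F.emb k) {y x : R3}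
    (hy : y ∈ c.toHomeo.source) (hx : fderiv ℝ c.toHomeo y x = 0) : x = 0 := by
  have hd : DifferentiableAt ℝ c.toHomeo.symm (c.toHomeo y) :=
    (c.smooth_symm.contDiffAt (c.toHomeo.open_target.mem_nhds
      (c.toHomeo.map_source hy))).differentiableAt (by simp)
  have h1 := hd.hasFDerivAt.comp y (differentiableAt_toHomeo c hy).hasFDerivAt
  have h2 : HasFDerivAt (c.toHomeo.symm ∘ c.toHomeo) (ContinuousLinearMap.id ℝ R3) y := by
    refine (hasFDerivAt_id y).congr_of_eventuallyEq ?_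
    filter_upwards [c.toHomeo.open_source.mem_nhds hy] with z hz
    exact c.toHomeo.left_inv hz
  have h3 := congrArg (fun L => L x) (h1.unique h2)
  simpa [hx] using h3.symm

/-- The normal vectors of the three sheets at a triple point are linearly independent. -/
theorem det_normals_ne_zero {w : Fin 3 → R3}
    (hw : ∀ j, F.IsUnitNormal (τ.chart.param j 0) (w j)) :
    (Matrix.of ![w 0, w 1, w 2]).det ≠ 0 := by
  intro h
  obtain ⟨x, hx, h0, h1, h2⟩ := exists_orthogonal_of_det_eq_zero h
  have hwx : ∀ j, w j ⬝ᵥ x = 0 := fun j => by fin_cases j <;> assumption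
  refine hx (fderiv_toHomeo_injective τ.chart.toSheetChart τ.chart.mem_source (funext fun j => ?_))
  have hm := param_zero_mem τ j
  -- Each normal is a nonzero multiple of its conormal, so orthogonality to it kills one coordinate
  -- of the derivative of the chart at `x`.
  have e := congrArg (fun u => u ⬝ᵥ x) (smul_eq_smul_conormal τ.chart.toSheetChart hm (hw j).2)
  simp only [smul_dotProduct, hwx, conormal_dotProduct, smul_eq_mul, mul_zero] at e
  have e' := (mul_eq_zero.mp e.symm).resolve_left
    (dside_ne_zero τ.chart.toSheetChart hm (hw j))
  rw [proj_param_zero, SheetChart.dside, τ.coord_eq] at e'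
  exact e'

open Classical in
-- The witness in the definition of `sign` is unique: a unit normal is determined by its side.
theorem sign_eq {ε : Octant} {w : Fin 3 → R3}
    (hw : ∀ j, F.IsUnitNormal (τ.chart.param j 0) (w j) ∧
      ε.point j * τ.chart.dside j τ.1 (w j) < 0) :
    τ.sign ε = if RightHanded (w 0) (w 1) (w 2) then 1 else -1 := by
  rw [TriplePt.sign]
  congr 1
  refine propext ⟨?_, fun h => ⟨w, hw, h⟩⟩
  rintro ⟨w', hw', h⟩
  have : w' = w := funext fun j => by
    refine isUnitNormal_unique τ.chart.toSheetChart (param_zero_mem τ j) (hw' j).1 (hw j).1 ?_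
    rw [proj_param_zero]
    have := mul_neg_trans (hw' j).2 (c := -τ.chart.dside j τ.1 (w j)) (by linarith [(hw j).2])
    linarith
  rwa [← this]

/-- Only the `j`-th normal is reversed, which negates the determinant; as the determinant is
nonzero, handedness really changes. -/
theorem sign_flip (ε : Octant) (j : Fin 3) : τ.sign (ε.flip j) = -τ.sign ε := by
  classical
  choose w hw using fun i => exists_isUnitNormal τ.chart.toSheetChart (param_zero_mem τ i)
    (neg_ne_zero.mpr (ε.point_ne_zero i))
  have h1 : ∀ i, F.IsUnitNormal (τ.chart.param i 0) (w i) ∧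
      ε.point i * τ.chart.dside i τ.1 (w i) < 0 := fun i => by
    have := (hw i).2
    rw [proj_param_zero] at this
    exact ⟨(hw i).1, by linarith⟩
  have h2 : ∀ i, F.IsUnitNormal (τ.chart.param i 0) (Function.update w j (-w j) i) ∧
      (ε.flip j).point i * τ.chart.dside i τ.1 (Function.update w j (-w j) i) < 0 := fun i => by
    rcases eq_or_ne i j with rfl | h
    · rw [Function.update_self, ε.flip_point_self, dside_neg, neg_mul_neg]
      exact ⟨isUnitNormal_neg (h1 i).1, (h1 i).2⟩
    · rw [Function.update_of_ne h, ε.flip_point_of_ne h]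
      exact h1 i
  rw [sign_eq τ h1, sign_eq τ h2, RightHanded, RightHanded, det_update_neg]
  rcases lt_or_gt_of_ne (det_normals_ne_zero τ fun i => (h1 i).1) with h | h
  · rw [if_pos (by linarith), if_neg h.not_gt, neg_neg]
  · rw [if_neg (by linarith), if_pos h]

end Sign

/-! ### The weight does not depend on the specified region -/

section Weight

variable {X Y : Type*} [SymmetricQuandle X] [MulAction (SymAssocGroup X)ᵐᵒᵖ Y]
  (a : F.SymAssignment X Y) (τ : F.TriplePt) (ε : Octant)

theorem labelFrom_flip_self (j : Fin 3) :
    a.labelFrom τ (ε.flip j) j = SymmetricQuandle.rho (a.labelFrom τ ε j) := by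
  change labelAt a τ.chart.toSheetChart j ((ε.flip j).point j) (τ.facePt (ε.flip j) j) = _
  rw [facePt_flip_self, ε.flip_point_self,
    labelAt_neg a _ (ε.point_ne_zero j) (τ.facePt_mem ε j)]
  rfl

theorem flip_eq_off_pair_left (i j k : Fin 3) (hk : k ∉ Set.range ![i, j]) :
    ε.flip i k = ε k :=
  ε.flip_of_ne fun h => hk ⟨0, h.symm⟩

theorem flip_eq_off_pair_right (i j k : Fin 3) (hk : k ∉ Set.range ![i, j]) :
    ε.flip j k = ε k :=
  ε.flip_of_ne fun h => hk ⟨1, h.symm⟩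

/-- Smaller indices are higher sheets: crossing sheet `j`, which lies below sheet `i`, does not
affect the label of the latter. -/
theorem labelFrom_flip_of_lt {i j : Fin 3} (h : i < j) :
    a.labelFrom τ (ε.flip j) i = a.labelFrom τ ε i := by
  have key := labelAt_eq_of_over a (octantChart τ ε ![i, j] (strictMono_pair h))
    (ε.point_ne_zero i)
    (facePt_mem_octantChart τ (strictMono_pair h) (flip_eq_off_pair_right ε i j) 0)
    (facePt_mem_octantChart τ (strictMono_pair h) (fun _ _ => rfl) 0) (by
      change τ.chart.side j (F.proj (τ.facePt (ε.flip j) i).1) *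
        τ.chart.side j (F.proj (τ.facePt ε i).1) < 0
      rw [side_facePt _ _ h.ne', side_facePt _ _ h.ne', ε.flip_point_self, neg_mul,
        ε.point_mul_self]
      norm_num)
  change labelAt a τ.chart.toSheetChart i ((ε.flip j).point i) (τ.facePt (ε.flip j) i) = _
  rw [ε.flip_point_of_ne h.ne]
  exact key

/-- Here sheet `j` is above sheet `i`, so crossing it passes from one under-semi-sheet to the other.
-/
theorem labelFrom_flip_of_gt {i j : Fin 3} (h : j < i) :
    a.labelFrom τ (ε.flip j) i = a.labelFrom τ ε j ◃ a.labelFrom τ ε i := by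
  have key := labelAt_act_labelAt a (octantChart τ ε ![j, i] (strictMono_pair h))
    (t := ε.point j) (ε.point_ne_zero i)
    (facePt_mem_octantChart τ (strictMono_pair h) (fun _ _ => rfl) 1)
    (facePt_mem_octantChart τ (strictMono_pair h) (flip_eq_off_pair_left ε j i) 1)
    (facePt_mem_octantChart τ (strictMono_pair h) (fun _ _ => rfl) 0) (by
      change 0 < ε.point j * τ.chart.side j (F.proj (τ.facePt ε i).1)
      rw [side_facePt _ _ h.ne, ε.point_mul_self]
      norm_num) (by
      change ε.point j * τ.chart.side j (F.proj (τ.facePt (ε.flip j) i).1) < 0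
      rw [side_facePt _ _ h.ne, ε.flip_point_self, mul_neg, ε.point_mul_self]
      norm_num)
  change labelAt a τ.chart.toSheetChart i ((ε.flip j).point i) (τ.facePt (ε.flip j) i) = _
  rw [ε.flip_point_of_ne h.ne']
  exact key.symm

theorem region_flip (j : Fin 3) :
    a.region (F.regionOf (τ.regionPt (ε.flip j))) =
      symSetAct (a.region (F.regionOf (τ.regionPt ε))) (a.labelFrom τ ε j) := by
  refine (symSetAct_region_labelAt a (octantChart τ ε ![j] (strictMono_single j))
    (t := ε.point j)
    (facePt_mem_octantChart τ (strictMono_single j) (fun _ _ => rfl) 0)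
    (regionPt_mem_octantChart τ (strictMono_single j) fun _ _ => rfl)
    (regionPt_mem_octantChart τ (strictMono_single j) fun k hk =>
      ε.flip_of_ne fun h => hk ⟨0, h.symm⟩) ?_ ?_).symm
  · change 0 < ε.point j * τ.chart.side j (τ.regionPt ε).1
    rw [side_regionPt, ε.point_mul_self]
    norm_num
  · change ε.point j * τ.chart.side j (τ.regionPt (ε.flip j)).1 < 0
    rw [side_regionPt, ε.flip_point_self, mul_neg, ε.point_mul_self]
    norm_num

/-- Crossing a sheet changes the region and the labels exactly as `flipAt` does, while the sign is
reversed. The two weights differ by a multiple of a generator of `symDegenerate`. -/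
theorem weight_flip (j : Fin 3) : a.weight τ (ε.flip j) = a.weight τ ε := by
  set z : Y × (Fin 3 → X) := (a.region (F.regionOf (τ.regionPt ε)),
    ![a.labelFrom τ ε 2, a.labelFrom τ ε 1, a.labelFrom τ ε 0])
  have hflip : (a.region (F.regionOf (τ.regionPt (ε.flip j))),
      ![a.labelFrom τ (ε.flip j) 2, a.labelFrom τ (ε.flip j) 1, a.labelFrom τ (ε.flip j) 0]) =
      flipAt j.rev z := by
    -- Tuples list the bottom sheet first and charts number the top sheet first, whence `Fin.rev`.
    have hj : z.2 j.rev = a.labelFrom τ ε j := by fin_cases j <;> rfl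
    refine Prod.ext ?_ (funext fun i => ?_)
    · rw [region_flip, flipAt, hj]
    · simp only [flipAt, hj]
      have hi : ∀ ε : Octant, ![a.labelFrom τ ε 2, a.labelFrom τ ε 1, a.labelFrom τ ε 0] i =
          a.labelFrom τ ε i.rev := fun ε => by fin_cases i <;> rfl
      have hzi : z.2 i = a.labelFrom τ ε i.rev := hi ε
      rw [hi, hzi]
      rcases lt_trichotomy i j.rev with h | h | h
      · rw [if_pos h, labelFrom_flip_of_gt a τ ε (Fin.lt_rev_iff.mp h)]
      · rw [if_neg h.not_lt, if_pos h, h, Fin.rev_rev, labelFrom_flip_self]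
      · rw [if_neg h.not_gt, if_neg h.ne', labelFrom_flip_of_lt a τ ε (Fin.rev_lt_iff.mp h)]
  rw [SymAssignment.weight, SymAssignment.weight, hflip, sign_flip]
  refine QuotientAddGroup.eq.mpr (AddSubgroup.mem_sup_right ?_)
  rw [neg_smul, neg_neg, ← smul_add, add_comm]
  refine AddSubgroup.zsmul_mem (symDegenerate X Y 3) (AddSubgroup.subset_closure ?_) _
  exact ⟨j.rev, z, rfl⟩

/-- Any octant is reached from any other by adjusting the three coordinates in turn, and each
adjustment is trivial or a flip. -/
theorem weight_eq (ε ε' : Octant) : a.weight τ ε = a.weight τ ε' := by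
  have h : ∀ (ε : Octant) (j : Fin 3) (s : ℤˣ),
      a.weight τ (Function.update ε j s) = a.weight τ ε := fun ε j s => by
    rcases Int.units_eq_one_or s with rfl | rfl <;>
      rcases Int.units_eq_one_or (ε j) with h | h
    · rw [← h, Function.update_eq_self]
    · rw [← weight_flip a τ ε j, Octant.flip, h, neg_neg]
    · rw [← weight_flip a τ ε j, Octant.flip, h]
    · rw [← h, Function.update_eq_self]
  rw [← h ε 0 (ε' 0), ← h _ 1 (ε' 1), ← h _ 2 (ε' 2)]
  congr 1
  funext j
  fin_cases j <;> simp

end Weight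

/-! ### Comparison of the weights -/

section Compare

variable {X Y : Type*} [Quandle X] [MulAction (AssocGroup X)ᵐᵒᵖ Y] {o : SurfaceOrientation M}

theorem canonChain_of_pos {n : ℕ} (z : Y × (Fin n → Double X)) (h : ∀ i, (z.2 i).pos = true) :
    canonChain z = FreeAbelianGroup.of (z.1, fun i => (z.2 i).elt) := by
  have key : ∀ l : List (Fin n), l.foldr canonStep ((1 : ℤ), z) = (1, z) := fun l => by
    induction l with
    | nil => rfl
    | cons i l ih => rw [List.foldr_cons, ih, canonStep, if_pos (h i)]
  simp only [canonChain, canon, key, one_smul]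

/-- The normal orientations that represent the orientation point from the source region. -/
theorem source_mul_dside_neg (τ : F.TriplePt) (j : Fin 3) {p : M} (hp : p ∈ τ.chart.sheet j)
    {v : R3} (hv : F.IsNormal o p v) :
    (τ.source o).point j * τ.chart.dside j (F.proj p) v < 0 := by
  have hm := param_zero_mem τ j
  rw [Octant.point, TriplePt.source]
  split_ifs with h
  · obtain ⟨w, hw, hpos⟩ := h
    have h1 := dside_mul_dside_pos τ.chart.toSheetChart hm hp hw hv
    rw [proj_param_zero] at h1
    have := pos_of_mul_pos_right h1 hpos.le
    push_cast
    linarith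
  -- The value `1` in `source` is a default. A normal does exist and points to some side, so here it
  -- points to the negative one.
  · obtain ⟨w, hw⟩ := exists_isNormal (o := o) τ.chart.toSheetChart hm
    have h1 := dside_mul_dside_pos τ.chart.toSheetChart hm hp hw hv
    have h2 := dside_ne_zero τ.chart.toSheetChart hm hw.1
    rw [proj_param_zero] at h1 h2
    have h3 := lt_of_le_of_ne (not_lt.mp fun h3 => h ⟨w, hw, h3⟩) h2
    push_cast
    nlinarith

/-- By independence of the region, the source region of `o` may be used. There all normals point
away and all labels are positive, so the tuple is already canonical. -/
theorem doubleToQ_weight (C : F.QColoring o X Y) (n : F.SemiPt → R3) (hn : Continuous n)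
    (hno : ∀ p : F.SemiPt, F.IsNormal o p.1 (n p)) (τ : F.TriplePt) (ε : Octant) :
    doubleToQ X Y 3 ((C.toSymAssignment n hn hno).weight τ ε) = C.weight τ := by
  rw [weight_eq _ τ ε (τ.source o)]
  have hlab : ∀ j, (C.toSymAssignment n hn hno).labelFrom τ (τ.source o) j =
      ⟨C.label (F.sheetOf (τ.facePt (τ.source o) j).toSheetPt), true⟩ := fun j =>
    if_pos (source_mul_dside_neg τ j (τ.facePt_mem _ j) (hno _))
  rw [SymAssignment.weight, hlab, hlab, hlab]
  change QuotientAddGroup.mk (FreeAbelianGroup.lift canonChain _) = _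
  rw [map_zsmul, FreeAbelianGroup.lift_apply_of, canonChain_of_pos _ (by
    intro i; fin_cases i <;> rfl)]
  rw [QColoring.weight]
  congr 4
  funext i
  fin_cases i <;> rfl

end Compare

end SurfaceDiagram

end SymDouble

end

/-! ### Equality of the two invariants -/

open SymDouble
theorem mainTheorem9 {M : Type*} [TopologicalSpace M]
    [ChartedSpace (EuclideanSpace ℝ (Fin 2)) M] [IsManifold (𝓡 2) ∞ M]
    [CompactSpace M] [T2Space M]
    (F : SurfaceDiagram M) (o : SurfaceOrientation M)
    {X Y A : Type*} [Quandle X] [MulAction (AssocGroup X)ᵐᵒᵖ Y] [AddCommGroup A]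
    (θQ : QChain X Y 3 →+ A) (θSQ : SQChain (Double X) Y 3 →+ A)
    (hQ : IsQCocycle θQ) (hSQ : IsSQCocycle θSQ)
    (hθ : θQ.comp (doubleToQ X Y 3) = θSQ)
    (c : F.OriClass X Y) (hc : c.Induces o)
    (γ : F.TriplePt → SurfaceDiagram.Octant) :
    MultisetEq (F.cocycleInvariant o θQ) (F.symCocycleInvariant c θSQ γ) := by
  -- An additive map commutes with `∑ᶠ` only for finite supports; this supplies finiteness.
  have := SurfaceDiagram.finite_triplePt (F := F)
  refine ⟨Equiv.ofBijective _ (SurfaceDiagram.QColoring.toOriClass_bijective c hc), fun C => ?_⟩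
  subst hθ
  change θQ (doubleToQ X Y 3 (∑ᶠ τ, _)) = θQ (∑ᶠ τ, C.weight τ)
  rw [AddMonoidHom.map_finsum _ (Set.toFinite _)]
  exact congrArg θQ (finsum_congr fun τ => SurfaceDiagram.doubleToQ_weight C _ _ hc τ (γ τ))
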